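/- **Notation.** Let $\langle\cdot,\cdot\rangle$ be the standard scalar product on $\mathbb R^n$, let $S^{n-1}$ be the unit sphere and $\sigma$ its rotation-invariant probability measure. A *cubature formula of strength $t$* on $S^{n-1}$ is a pair $(X,W)$, where $X\subset S^{n-1}$ is finite and $W(x)>0$ for $x\in X$, such that $\sum_{x\in X}W(x)f(x)=\int_{S^{n-1}}f\,d\sigma$ for every polynomial function $f:\mathbb R^n\to\mathbb C$ of degree at most $t$. If $W$ is the constant $1/|X|$, then $X$ is a *spherical $t$-design*. Let $\Lambda\subset\mathbb R^{24}$ be the Leech lattice, i.e. an even unimodular lattice of rank $24$ in $\mathbb R^{24}$ without vectors $x$ with $\langle x,x\rangle=2$. Put $\Lambda_m=\{x\in\Lambda:\langle x,x\rangle=m\}$ and $X^{(m)}=\frac1{\sqrt m}\Lambda_m\subset S^{23}$ for $m>0$. Let $\mathrm{Har}_k$ be the space of complex harmonic polynomials on $\mathbb R^{24}$ that are homogeneous of degree $k$, and put $\Theta_{\Lambda,P}(z)=\sum_{x\in\Lambda}P(x)e^{i\pi z\langle x,x\rangle}$ for $\operatorname{Im}z>0$. Let $E_4,E_6$ be the Eisenstein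 series of level one with constant term $1$, and $\Delta=\eta^{24}$. **Theorem.** 1. *(Theta series.)* The series $\Theta_{\Lambda,P}(z)$ below converge absolutely. One has $\Theta_{\Lambda,1}=E_4^3-720\Delta$, and $\Theta_{\Lambda,P}=0$ for $P\in\mathrm{Har}_k$, $k\in\{2,4,6,8,10,14\}$. There are linear forms $c_1,c_2,c_3$ on $\mathrm{Har}_{12},\mathrm{Har}_{16},\mathrm{Har}_{18}$ such that $\Theta_{\Lambda,P}=c_1(P)\Delta^2$, $c_2(P)E_4\Delta^2$, $c_3(P)E_6\Delta^2$ for $P$ in $\mathrm{Har}_{12}$, $\mathrm{Har}_{16}$, $\mathrm{Har}_{18}$ respectively. 2. *(Disjointness.)* The sets $X^{(4)},X^{(6)},X^{(8)},X^{(10)}$ are pairwise disjoint. 3. *(Strength 11.)* For every integer $m>0$ with $\Lambda_m\ne\emptyset$, the set $X^{(m)}$ is a spherical $11$-design; moreover $|X^{(4)}|=196\,560$. 4. *(Strength 15.)* The set $X=X^{(4)}\cup X^{(6)}$ has $16\,969\,680$ elements. With weight $W_1=\frac1{4176900}$ on $X^{(4)}$ and $W_2=(3/4)^5W_1$ on $X^{(6)}$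 it is a cubature formula of strength $15$ on $S^{23}$. 5. *(Strength 17.)* The set $X=X^{(4)}\cup X^{(6)}\cup X^{(8)}$ has $415\,003\,680$ elements. With the weights $\frac1{555527700}$, $\frac{27}{3009843200}$, $\frac{8}{3749811975}$ on $X^{(4)}$, $X^{(6)}$, $X^{(8)}$ respectively it is a cubature formula of strength $17$ on $S^{23}$. 6. *(Strength 19.)* The set $X=X^{(4)}\cup X^{(6)}\cup X^{(8)}\cup X^{(10)}$ has $5\,044\,384\,800$ elements. With the weights $\frac1{749962395}$, $\frac{243}{185406341120}$, $\frac{32}{41247931725}$, $\frac{15625}{108128978141184}$ on $X^{(4)}$, $X^{(6)}$, $X^{(8)}$, $X^{(10)}$ respectively it is a cubature formula of strength $19$ on $S^{23}$. -/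

import Mathlib

open MeasureTheory
open scoped UpperHalfPlane

noncomputable section

/-- The value at `x ∈ ℝⁿ` of the complex polynomial function given by `p`. -/
def polyEval {n : ℕ} (p : MvPolynomial (Fin n) ℂ) (x : EuclideanSpace ℝ (Fin n)) : ℂ :=
  MvPolynomial.eval (fun i => (x i : ℂ)) p

/-- The rotation-invariant measure on the unit sphere of `ℝⁿ`, normalised to total mass one. -/
def sphereMeasure (n : ℕ) : Measure (Metric.sphere (0 : EuclideanSpace ℝ (Fin n)) 1) :=
  ((volume : Measure (EuclideanSpace ℝ (Fin n))).toSphere Set.univ)⁻¹ •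
    (volume : Measure (EuclideanSpace ℝ (Fin n))).toSphere

/-- `(X, W)` is a cubature formula of strength `t` on the unit sphere of `ℝⁿ`:
`X` is a finite set of points of the sphere, the weights are positive, and the weighted sum over `X`
of every polynomial function of degree at most `t` is its mean value over the sphere. -/
structure IsCubatureFormula {n : ℕ} (t : ℕ) (X : Set (EuclideanSpace ℝ (Fin n)))
    (W : EuclideanSpace ℝ (Fin n) → ℝ) : Prop where
  finite : X.Finite
  subset_sphere : X ⊆ Metric.sphere 0 1
  weight_pos : ∀ x ∈ X, 0 < W x
  sum_eq_integral : ∀ p : MvPolynomial (Fin n) ℂ, p.totalDegree ≤ t →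
    ∑ x ∈ finite.toFinset, (W x : ℂ) * polyEval p x =
      ∫ u : Metric.sphere (0 : EuclideanSpace ℝ (Fin n)) 1, polyEval p u ∂(sphereMeasure n)

/-- A spherical `t`-design: a cubature formula with constant weight `1 / |X|`. -/
def IsSphericalDesign {n : ℕ} (t : ℕ) (X : Set (EuclideanSpace ℝ (Fin n))) : Prop :=
  IsCubatureFormula t X (fun _ => (X.ncard : ℝ)⁻¹)

/-- The shell of norm `m` of `L`: its vectors with `⟪x, x⟫ = m`. -/
def shell {n : ℕ} (L : Submodule ℤ (EuclideanSpace ℝ (Fin n))) (m : ℕ) :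
    Set (EuclideanSpace ℝ (Fin n)) :=
  {x | x ∈ L ∧ inner ℝ x x = (m : ℝ)}

/-- The shell of norm `m`, rescaled by `1 / √m`. -/
def rescaledShell {n : ℕ} (L : Submodule ℤ (EuclideanSpace ℝ (Fin n))) (m : ℕ) :
    Set (EuclideanSpace ℝ (Fin n)) :=
  (fun x => (√(m : ℝ))⁻¹ • x) '' shell L m

/-- The union of the rescaled shells of norms `m ∈ M`. -/
def shellUnion {n : ℕ} (L : Submodule ℤ (EuclideanSpace ℝ (Fin n))) (M : Finset ℕ) :
    Set (EuclideanSpace ℝ (Fin n)) :=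
  ⋃ m ∈ M, rescaledShell L m

/-- The weight function `W(x) = ∑ w m`, over the `m ∈ M` whose rescaled shell contains `x`. -/
def shellWeight {n : ℕ} (L : Submodule ℤ (EuclideanSpace ℝ (Fin n))) (M : Finset ℕ) (w : ℕ → ℝ)
    (x : EuclideanSpace ℝ (Fin n)) : ℝ :=
  ∑ m ∈ M, (rescaledShell L m).indicator (fun _ => w m) x

/-- `L` is a lattice of full rank in `ℝⁿ`, even, and unimodular (equal to its dual lattice). -/
structure IsEvenUnimodular {n : ℕ} (L : Submodule ℤ (EuclideanSpace ℝ (Fin n))) : Prop where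
  discrete : DiscreteTopology L
  span_eq_top : Submodule.span ℝ (L : Set (EuclideanSpace ℝ (Fin n))) = ⊤
  even : ∀ x ∈ L, ∃ k : ℤ, inner ℝ x x = 2 * (k : ℝ)
  dual_eq : LinearMap.BilinForm.dualSubmodule (innerₗ (EuclideanSpace ℝ (Fin n))) L = L

/-- `L` is a Leech lattice: an even unimodular lattice in `ℝ²⁴` without vectors of norm `2`. -/
structure IsLeechLattice (L : Submodule ℤ (EuclideanSpace ℝ (Fin 24))) : Prop where
  evenUnimodular : IsEvenUnimodular L
  shell_two : shell L 2 = ∅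

/-- The Laplacian `∑ i, (∂ / ∂ x i) ^ 2` on polynomials. -/
def polyLaplacian (n : ℕ) : MvPolynomial (Fin n) ℂ →ₗ[ℂ] MvPolynomial (Fin n) ℂ :=
  ∑ i : Fin n, (MvPolynomial.pderiv i).toLinearMap ∘ₗ (MvPolynomial.pderiv i).toLinearMap

/-- The space of harmonic polynomials on `ℝⁿ` that are homogeneous of degree `k`. -/
def harmonicPoly (n k : ℕ) : Submodule ℂ (MvPolynomial (Fin n) ℂ) :=
  MvPolynomial.homogeneousSubmodule (Fin n) ℂ k ⊓ LinearMap.ker (polyLaplacian n)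

/-- The theta series of `L` with coefficient `P` equals `f` on the upper half-plane:
for every `z` the series `∑ x ∈ L, P(x) q ^ ⟪x, x⟫` with `q = exp (π i z)`
converges absolutely, with sum `f z`. -/
def HasThetaSeries {n : ℕ} (L : Submodule ℤ (EuclideanSpace ℝ (Fin n)))
    (P : MvPolynomial (Fin n) ℂ) (f : ℍ → ℂ) : Prop :=
  ∀ z : ℍ, HasSum
    (fun x : L => polyEval P (x : EuclideanSpace ℝ (Fin n)) *
      Complex.exp (Real.pi * Complex.I * (z : ℂ) *
        ((inner ℝ (x : EuclideanSpace ℝ (Fin n)) (x : EuclideanSpace ℝ (Fin n)) : ℝ) : ℂ)))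
    (f z)

end

/-!
The theta series of an even unimodular lattice of rank 24, with a harmonic coefficient `P` of
degree `k`, is a modular form of level one and weight `12 + k` (`IsEvenUnimodular.thetaForm`).
Invariance under `z ↦ z + 1` is evenness of the lattice. The behaviour under `z ↦ -1 / z` is
Poisson summation (`exists_poisson_summation`) for `P(x) exp (-b ‖x‖²)`, whose Fourier transform is
of the same form because the heat operator fixes a harmonic polynomial
(`fourier_harmonicPoly_mul_gaussian`).

For a Leech lattice the coefficient of `q` vanishes, since there are no vectors of norm 2, and for
`k > 0` so does the constant coefficient. A form of level one and weight `w` is determined by its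
coefficients of degree at most `w / 12`. This gives `E₄³ - 720 Δ` for `P = 1`, zero in the degrees
2, 4, 6, 8 and 10, and a multiple of `Δ²`, `E₄ Δ²`, `E₆ Δ²` in the degrees 12, 16, 18. In degree 14
the weight is 26 and dividing by `Δ²` leaves a form of weight 2, which is zero
(`levelOne_weight_26_eq_zero`). The coefficients of `E₄³ - 720 Δ` are the sizes of the shells, and
those of the other forms are, up to a common factor, the sums of `P` over the shells.

Every homogeneous polynomial is a harmonic one plus a multiple of `‖x‖²`
(`exists_eq_harmonic_add_normSqPoly_mul`), and harmonic polynomials of positive degree have mean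
value zero on the sphere (`integral_sphere_harmonic`). A cubature formula of strength `t` is thus a
positive weight of total mass one that annihilates the harmonic polynomials of degrees `1, …, t`
(`isCubatureFormula_of_harmonic`). Odd degrees are annihilated since shells are symmetric. Among the
even degrees up to 19 the theta series leave only 12, 16 and 18, so that the theorem comes down to
a system of linear equations for the weights, with the coefficients of `Δ²`, `E₄ Δ²` and `E₆ Δ²`.

The rescaled shells are disjoint because a common point of two of them would give lattice vectors
with inner product `√(a b)`, where `a` and `b` are two of the norms 4, 6, 8, 10, and this is not an
integer.
-/

/-! ### Sums over lattices -/

namespace ZLattice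

open Module

variable {E : Type*} [NormedAddCommGroup E]

lemma one_add_norm_inv_pow_add_le {x t : E} {R : ℝ} (ht : ‖t‖ ≤ R) (N : ℕ) :
    (1 + ‖x + t‖)⁻¹ ^ N ≤ (1 + R) ^ N * (1 + ‖x‖)⁻¹ ^ N := by
  rw [← mul_pow]
  refine pow_le_pow_left₀ (by positivity) ?_ N
  have h1 : ‖x‖ ≤ ‖x + t‖ + ‖t‖ := by simpa using norm_sub_le (x + t) t
  have h2 := norm_nonneg (x + t)
  have h3 := norm_nonneg t
  rw [← div_eq_mul_inv, inv_eq_one_div, div_le_div_iff₀ (by positivity) (by positivity)]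
  nlinarith [mul_nonneg (h3.trans ht) h2]

variable [NormedSpace ℝ E] [FiniteDimensional ℝ E]
  (L : Submodule ℤ E) [DiscreteTopology L] [IsZLattice ℝ L]

lemma summable_one_add_norm_inv_pow {N : ℕ} (hN : finrank ℝ E < N) :
    Summable fun x : L ↦ (1 + ‖(x : E)‖)⁻¹ ^ N := by
  have h0 : N ≠ 0 := by omega
  refine Summable.of_norm_bounded_eventually (summable_norm_pow_inv L N ?_) ?_
  · rwa [ZLattice.rank ℝ L]
  · refine (Set.finite_singleton (0 : L)).subset fun x hx ↦ ?_
    by_contra hx0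
    refine hx ?_
    change ‖(1 + ‖(x : E)‖)⁻¹ ^ N‖ ≤ _
    have : 0 < ‖x‖ := norm_pos_iff.mpr hx0
    rw [Real.norm_of_nonneg (by positivity)]
    refine pow_le_pow_left₀ (by positivity) (inv_anti₀ this ?_) N
    simp

/-- The sum over the translates of a lattice of a continuous function with sufficient decay
is continuous. -/
lemma continuous_tsum_translate {f : E → ℂ} (hf : Continuous f) {C : ℝ} {N : ℕ}
    (hN : finrank ℝ E < N) (hC : ∀ x, ‖f x‖ ≤ C * (1 + ‖x‖)⁻¹ ^ N) :
    Continuous fun t ↦ ∑' x : L, f (x + t) := by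
  refine continuous_iff_continuousAt.mpr fun t₀ ↦ ?_
  have hC0 : 0 ≤ C := by simpa using (norm_nonneg _).trans (hC 0)
  refine ContinuousOn.continuousAt (s := Metric.ball 0 (‖t₀‖ + 1)) ?_
    (Metric.isOpen_ball.mem_nhds (by simp))
  refine continuousOn_tsum (u := fun x : L ↦ C * ((1 + (‖t₀‖ + 1)) ^ N * (1 + ‖(x : E)‖)⁻¹ ^ N))
    (fun x ↦ by fun_prop) (((summable_one_add_norm_inv_pow L hN).mul_left _).mul_left _) ?_
  intro x t ht
  refine (hC _).trans (mul_le_mul_of_nonneg_left (one_add_norm_inv_pow_add_le ?_ N) hC0)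
  simpa using (mem_ball_zero_iff.mp ht).le

end ZLattice

/-! ### Poisson summation -/

section Poisson

open Module FourierTransform

variable {E : Type*} [NormedAddCommGroup E] [InnerProductSpace ℝ E] [FiniteDimensional ℝ E]

lemma isOpenQuotientMap_mk_unitAddTorus (ι : Type*) [Finite ι] :
    IsOpenQuotientMap (fun (t : ι → ℝ) (i : ι) ↦ (t i : UnitAddCircle)) :=
  IsOpenQuotientMap.piMap fun _ ↦ QuotientAddGroup.isOpenQuotientMap_mk

variable (L : Submodule ℤ E) [DiscreteTopology L] [IsZLattice ℝ L]
  {ι : Type*} [Fintype ι] (b : Basis ι ℤ L)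

/-- The linear coordinates on `E` given by a basis of the lattice `L`. -/
noncomputable def latticeCoord : (ι → ℝ) ≃L[ℝ] E :=
  (b.ofZLatticeBasis ℝ L).equivFun.symm.toContinuousLinearEquiv

lemma latticeCoord_apply (t : ι → ℝ) : latticeCoord L b t = ∑ i, t i • (b i : E) := by
  simp [latticeCoord, Basis.equivFun_symm_apply]

lemma latticeCoord_intCast_mem (m : ι → ℤ) : latticeCoord L b (fun i ↦ (m i : ℝ)) ∈ L := by
  rw [latticeCoord_apply]
  refine L.sum_mem fun i _ ↦ ?_
  rw [Int.cast_smul_eq_zsmul]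
  exact L.smul_mem _ (b i).2

lemma preimage_fundamentalDomain :
    latticeCoord L b ⁻¹' (ZSpan.fundamentalDomain (b.ofZLatticeBasis ℝ L)) =
      Set.pi Set.univ fun _ ↦ Set.Ico (0 : ℝ) 1 := by
  ext t
  have h (i : ι) : (b.ofZLatticeBasis ℝ L).repr (latticeCoord L b t) i = t i :=
    congr_fun ((b.ofZLatticeBasis ℝ L).equivFun.apply_symm_apply t) i
  simp [ZSpan.mem_fundamentalDomain, h]

variable [MeasurableSpace E] [BorelSpace E]

/-- The Haar measure on `E` for which the lattice spanned by `b` has covolume one. -/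
noncomputable def latticeMeasure : Measure E := Measure.map (latticeCoord L b) volume

instance : (latticeMeasure L b).IsAddHaarMeasure :=
  (latticeCoord L b).isAddHaarMeasure_map _

lemma setIntegral_fundamentalDomain (F : E → ℂ) :
    ∫ x in ZSpan.fundamentalDomain (b.ofZLatticeBasis ℝ L), F x ∂(latticeMeasure L b) =
      ∫ t in {t : ι → ℝ | ∀ i, t i ∈ Set.Ioc ((0 : ι → ℝ) i) ((0 : ι → ℝ) i + 1)},
        F (latticeCoord L b t) := by
  have he : MeasurableEmbedding (latticeCoord L b) :=
    (latticeCoord L b).toHomeomorph.measurableEmbedding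
  rw [latticeMeasure, he.setIntegral_map, preimage_fundamentalDomain]
  have : {t : ι → ℝ | ∀ i, t i ∈ Set.Ioc ((0 : ι → ℝ) i) ((0 : ι → ℝ) i + 1)} =
    Set.pi Set.univ fun _ ↦ Set.Ioc (0 : ℝ) 1 := by ext; simp
  rw [this]
  exact setIntegral_congr_set
    (Measure.univ_pi_Ico_ae_eq_Icc.trans Measure.univ_pi_Ioc_ae_eq_Icc.symm)

/-- Periodizing along `L` turns an integral over `E` into one over a fundamental domain. -/
lemma integral_latticeMeasure_mul {f g : E → ℂ} (hf : Continuous f) (hg : Continuous g)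
    {C : ℝ} {N : ℕ} (hN : finrank ℝ E < N) (hC : ∀ x, ‖f x‖ ≤ C * (1 + ‖x‖)⁻¹ ^ N)
    (hg1 : ∀ x, ‖g x‖ ≤ 1) (hgL : ∀ (x : L) (t : E), g (x + t) = g t) :
    ∫ t in ZSpan.fundamentalDomain (b.ofZLatticeBasis ℝ L),
      g t * ∑' x : L, f (x + t) ∂(latticeMeasure L b) =
        ∫ t, g t * f t ∂(latticeMeasure L b) := by
  have hC0 : 0 ≤ C := by simpa using (norm_nonneg _).trans (hC 0)
  have hint : Integrable (fun t ↦ g t * f t) (latticeMeasure L b) := by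
    refine Integrable.mono' (g := fun t ↦ C * (1 + ‖t‖) ^ (-(N : ℝ)))
      ((integrable_one_add_norm (by exact_mod_cast hN)).const_mul C)
      (by fun_prop) (ae_of_all _ fun t ↦ ?_)
    rw [norm_mul, Real.rpow_neg (by positivity), Real.rpow_natCast, ← inv_pow]
    calc ‖g t‖ * ‖f t‖ ≤ 1 * ‖f t‖ := by gcongr; exact hg1 t
      _ ≤ _ := by simpa using hC t
  have hfd := ZLattice.isAddFundamentalDomain b (latticeMeasure L b)
  have : VAddInvariantMeasure L E (latticeMeasure L b) :=
    ⟨fun x s _ ↦ measure_preimage_add (latticeMeasure L b) (x : E) s⟩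
  rw [hfd.integral_eq_tsum'' _ hint]
  set D := ZSpan.fundamentalDomain (b.ofZLatticeBasis ℝ L) with hD
  obtain ⟨R, hR⟩ := (ZSpan.fundamentalDomain_isBounded (b.ofZLatticeBasis ℝ L)).exists_norm_le
  have hDm : MeasurableSet D := ZSpan.fundamentalDomain_measurableSet _
  have hDfin : (latticeMeasure L b) D < ⊤ :=
    (ZSpan.fundamentalDomain_isBounded (b.ofZLatticeBasis ℝ L)).measure_lt_top
  have : IsFiniteMeasure ((latticeMeasure L b).restrict D) := ⟨by simpa using hDfin⟩
  have hb (x : L) : ∀ t ∈ D, ‖g (x + t) * f (x + t)‖ ≤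
      C * ((1 + R) ^ N * (1 + ‖(x : E)‖)⁻¹ ^ N) := fun t ht ↦ by
    rw [norm_mul]
    calc ‖g (x + t)‖ * ‖f (x + t)‖ ≤ 1 * ‖f (x + t)‖ := by gcongr; exact hg1 _
      _ ≤ _ := by
        rw [one_mul]
        exact (hC _).trans (mul_le_mul_of_nonneg_left
          (ZLattice.one_add_norm_inv_pow_add_le (hR t ht) N) hC0)
  have hs : Summable fun x : L ↦ C * ((1 + R) ^ N * (1 + ‖(x : E)‖)⁻¹ ^ N) :=
    ((ZLattice.summable_one_add_norm_inv_pow L hN).mul_left _).mul_left _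
  have hae (x : L) : ∀ᵐ t ∂((latticeMeasure L b).restrict D), ‖g (x + t) * f (x + t)‖ ≤
      C * ((1 + R) ^ N * (1 + ‖(x : E)‖)⁻¹ ^ N) :=
    (ae_restrict_iff' hDm).mpr (ae_of_all _ (hb x))
  have hi (x : L) : Integrable (fun t ↦ g (x + t) * f (x + t))
      ((latticeMeasure L b).restrict D) :=
    Integrable.mono' (integrable_const _) (by fun_prop) (hae x)
  change _ = ∑' x : L, ∫ t in D, g (x + t) * f (x + t) ∂(latticeMeasure L b)
  rw [integral_tsum_of_summable_integral_norm hi]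
  · refine integral_congr_ae (ae_of_all _ fun t ↦ ?_)
    simp only [hgL, tsum_mul_left]
  · refine Summable.of_nonneg_of_le (fun x ↦ integral_nonneg fun t ↦ norm_nonneg _)
      (fun x ↦ ?_) (hs.mul_right (((latticeMeasure L b).restrict D).real Set.univ))
    have := integral_mono_ae (hi x).norm (integrable_const _) (hae x)
    simpa [mul_comm] using this

/-- **Poisson summation** for a lattice `L` in a Euclidean space, with dual lattice `M`. The
positive constant `c` is the inverse of the covolume of `L`. -/
theorem exists_poisson_summation (M : Submodule ℤ E)
    (hM : ∀ y, y ∈ M ↔ ∀ x ∈ L, ∃ k : ℤ, inner ℝ x y = (k : ℝ)) :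
    ∃ c : ℝ, 0 < c ∧ ∀ (f : E → ℂ) (C : ℝ) (N : ℕ), Continuous f → finrank ℝ E < N →
      (∀ x, ‖f x‖ ≤ C * (1 + ‖x‖)⁻¹ ^ N) → Summable (fun y : M ↦ 𝓕 f (y : E)) →
      ∑' x : L, f x = c * ∑' y : M, 𝓕 f (y : E) := by
  have := ZLattice.module_free ℝ L
  have := ZLattice.module_finite ℝ L
  let b := Module.Free.chooseBasis ℤ L
  let ι := Module.Free.ChooseBasisIndex ℤ L
  let bR := b.ofZLatticeBasis ℝ L
  have hbR (i : ι) : bR i = b i := by simp [bR]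
  -- the dual lattice is identified with the character group of the torus
  have hk (y : M) (i : ι) : ∃ k : ℤ, inner ℝ (b i : E) (y : E) = (k : ℝ) :=
    (hM y).mp y.2 _ (b i).2
  choose κ hκ using hk
  have hκbij : Function.Bijective κ := by
    refine ⟨fun y y' h ↦ Subtype.ext (InnerProductSpace.ext_inner_left_basis bR fun i ↦ ?_),
      fun m ↦ ?_⟩
    · rw [hbR, hκ, hκ, h]
    · let ℓ : E →L[ℝ] ℝ := LinearMap.toContinuousLinearMap (bR.constr ℝ fun i ↦ (m i : ℝ))
      let y : E := (InnerProductSpace.toDual ℝ E).symm ℓ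
      have hy (x : E) : inner ℝ x y = ℓ x := by
        rw [real_inner_comm]; exact InnerProductSpace.toDual_symm_apply
      have hyb (i : ι) : inner ℝ (b i : E) y = (m i : ℝ) := by
        rw [hy, ← hbR]; simp [ℓ]
      have hyM : y ∈ M := (hM y).mpr fun x hx ↦ by
        refine ⟨∑ i, b.repr ⟨x, hx⟩ i * m i, ?_⟩
        have : x = ∑ i, (b.repr ⟨x, hx⟩ i) • (b i : E) := by
          conv_lhs => rw [show x = ((⟨x, hx⟩ : L) : E) from rfl, ← b.sum_repr ⟨x, hx⟩]
          rw [AddSubmonoidClass.coe_finsetSum]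
          rfl
        conv_lhs => rw [this]
        simp [sum_inner, ← Int.cast_smul_eq_zsmul ℝ, inner_smul_left, hyb]
      refine ⟨⟨y, hyM⟩, funext fun i ↦ ?_⟩
      have := (hκ ⟨y, hyM⟩ i).symm.trans (hyb i)
      exact_mod_cast this
  have hκA (y : M) (t : ι → ℝ) : inner ℝ (latticeCoord L b t) (y : E) = ∑ i, t i * κ y i := by
    simp [latticeCoord_apply, sum_inner, inner_smul_left, hκ, ι, b]
  let c := Measure.addHaarScalarFactor (latticeMeasure L b) (volume : Measure E)
  have hc : latticeMeasure L b = c • (volume : Measure E) :=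
    Measure.isAddLeftInvariant_eq_smul _ _
  refine ⟨c, NNReal.coe_pos.mpr
    (Measure.addHaarScalarFactor_pos_of_isAddHaarMeasure _ _), fun f C N hf hN hC hsum ↦ ?_⟩
  -- the periodization of `f` descends to a continuous function on the torus
  let A := latticeCoord L b
  let Φ : E → ℂ := fun t ↦ ∑' x : L, f (x + t)
  have hΦ : Continuous Φ := ZLattice.continuous_tsum_translate L hf hN hC
  have hΦL (x : L) (t : E) : Φ (x + t) = Φ t := by
    have := (Equiv.addRight x).tsum_eq fun x' : L ↦ f (x' + t)
    simpa [Φ, add_assoc] using this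
  let q : (ι → ℝ) → UnitAddTorus ι := fun t i ↦ (t i : UnitAddCircle)
  have hq : IsOpenQuotientMap q := isOpenQuotientMap_mk_unitAddTorus ι
  have hqA (t t' : ι → ℝ) (h : q t = q t') : Φ (A t) = Φ (A t') := by
    have h1 (i : ι) : ∃ m : ℤ, (m : ℝ) = t i - t' i := by
      have := congr_fun h i
      rw [← sub_eq_zero] at this
      have h2 : ((t i - t' i : ℝ) : UnitAddCircle) = 0 := this
      obtain ⟨m, hm⟩ := (AddCircle.coe_eq_zero_iff 1).mp h2
      exact ⟨m, by simpa using hm⟩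
    choose m hm using h1
    have h2 : A t = A (fun i ↦ (m i : ℝ)) + A t' := by
      rw [← map_add]; congr 1; ext i; simp [hm]
    rw [h2]
    exact hΦL ⟨_, latticeCoord_intCast_mem L b m⟩ _
  let Ψ₀ : UnitAddTorus ι → ℂ := fun s ↦ Φ (A (hq.surjective s).choose)
  have hΨ₀ (t : ι → ℝ) : Ψ₀ (q t) = Φ (A t) := hqA _ _ (hq.surjective (q t)).choose_spec
  have hΨc : Continuous Ψ₀ := by
    refine hq.isQuotientMap.continuous_iff.mpr ?_
    have : Ψ₀ ∘ q = Φ ∘ A := funext hΨ₀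
    rw [this]
    exact hΦ.comp A.continuous
  let Ψ : C(UnitAddTorus ι, ℂ) := ⟨Ψ₀, hΨc⟩
  -- its Fourier coefficients are values of the Fourier transform of `f`
  have hchar (y : M) (t : ι → ℝ) : UnitAddTorus.mFourier (-κ y) (q t) =
      (Real.fourierChar (-inner ℝ (A t) (y : E)) : ℂ) := by
    simp only [UnitAddTorus.mFourier, ContinuousMap.coe_mk, q, A, hκA, fourier_coe_apply,
      Real.fourierChar_apply, ← Complex.exp_sum]
    congr 1
    push_cast
    rw [← Finset.sum_neg_distrib, Finset.mul_sum, Finset.sum_mul]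
    refine Finset.sum_congr rfl fun i _ ↦ ?_
    simp
    ring
  have hcoeff (y : M) : UnitAddTorus.mFourierCoeff Ψ (κ y) = ((c : ℝ) : ℂ) * 𝓕 f (y : E) := by
    rw [UnitAddTorus.mFourierCoeff_eq_integral _ _ 0]
    have h1 := setIntegral_fundamentalDomain L b
      (fun t ↦ (Real.fourierChar (-inner ℝ t (y : E)) : ℂ) * Φ t)
    have h2 : 𝓕 f (y : E) = ∫ t, (Real.fourierChar (-inner ℝ t (y : E)) : ℂ) * f t := by
      rw [Real.fourier_eq]; rfl
    calc _ = _ := integral_congr_ae (ae_of_all _ fun t ↦ ?_)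
      _ = _ := h1.symm
      _ = _ := integral_latticeMeasure_mul L b hf (by fun_prop) hN hC
          (fun t ↦ (Circle.norm_coe _).le) ?_
      _ = _ := by rw [hc, integral_smul_nnreal_measure, h2]; rfl
    · change UnitAddTorus.mFourier (-κ y) (q t) * Ψ₀ (q t) = _
      rw [hchar, hΨ₀]
    · intro x t
      obtain ⟨k, hk⟩ := (hM y).mp y.2 x x.2
      rw [inner_add_left, hk, Real.fourierChar_apply, Real.fourierChar_apply]
      refine Complex.exp_eq_exp_iff_exists_int.mpr ⟨-k, ?_⟩
      push_cast
      ring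
  let e := Equiv.ofBijective κ hκbij
  have hsumΨ : Summable (UnitAddTorus.mFourierCoeff Ψ) := by
    rw [← e.summable_iff]
    refine (hsum.mul_left ((c : ℝ) : ℂ)).congr fun y ↦ (hcoeff y).symm
  have h := UnitAddTorus.hasSum_mFourier_series_apply_of_summable hsumΨ (q 0)
  rw [← e.hasSum_iff] at h
  have hone (m : ι → ℤ) : UnitAddTorus.mFourier m (q 0) = 1 := by
    simp [UnitAddTorus.mFourier, q]
  have h0 : Ψ (q 0) = ∑' x : L, f x := by
    change Ψ₀ (q 0) = _
    rw [hΨ₀]; simp [Φ]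
  rw [← h0, ← h.tsum_eq, ← tsum_mul_left]
  refine tsum_congr fun y ↦ ?_
  simp only [Function.comp_apply, hone, smul_eq_mul, mul_one]
  exact hcoeff y

end Poisson

/-! ### The Laplacian and the heat operator on polynomials -/

section HeatOperator

open MvPolynomial

variable {n : ℕ}

lemma pderiv_comm (i j : Fin n) (p : MvPolynomial (Fin n) ℂ) :
    pderiv i (pderiv j p) = pderiv j (pderiv i p) := by
  have h : ⁅pderiv (R := ℂ) i, pderiv (R := ℂ) j⁆ = 0 := by
    refine MvPolynomial.derivation_ext fun k ↦ ?_
    simp [Derivation.commutator_apply, pderiv_X, Pi.single_apply, apply_ite (pderiv _)]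
  have := DFunLike.congr_fun h p
  rwa [Derivation.commutator_apply, Derivation.zero_apply, sub_eq_zero] at this

lemma polyLaplacian_apply (p : MvPolynomial (Fin n) ℂ) :
    polyLaplacian n p = ∑ i, pderiv i (pderiv i p) := by
  simp [polyLaplacian]

lemma pderiv_polyLaplacian (i : Fin n) (p : MvPolynomial (Fin n) ℂ) :
    pderiv i (polyLaplacian n p) = polyLaplacian n (pderiv i p) := by
  simp only [polyLaplacian_apply, map_sum]
  exact Finset.sum_congr rfl fun j _ ↦ by rw [pderiv_comm, pderiv_comm i j]

lemma polyLaplacian_mul_X (i : Fin n) (p : MvPolynomial (Fin n) ℂ) :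
    polyLaplacian n (p * X i) = polyLaplacian n p * X i + 2 • pderiv i p := by
  have h (j : Fin n) : pderiv j (pderiv j (p * X i)) =
      pderiv j (pderiv j p) * X i + if j = i then 2 • pderiv i p else 0 := by
    by_cases hij : j = i
    · subst hij
      simp only [pderiv_mul, pderiv_X_self, map_add, mul_one, if_true]
      ring
    · simp [pderiv_X_of_ne (Ne.symm hij), hij, mul_comm]
  simp only [polyLaplacian_apply, h, Finset.sum_add_distrib, Finset.sum_mul, Finset.sum_ite_eq',
    Finset.mem_univ, if_true]

lemma polyLaplacian_pow_succ_mul_X (i : Fin n) (j : ℕ) (p : MvPolynomial (Fin n) ℂ) :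
    (polyLaplacian n ^ (j + 1)) (p * X i) = (polyLaplacian n ^ (j + 1)) p * X i +
      (2 * (j + 1 : ℂ)) • pderiv i ((polyLaplacian n ^ j) p) := by
  induction j with
  | zero => simp [polyLaplacian_mul_X, ← Nat.cast_smul_eq_nsmul ℂ]
  | succ j ih =>
    rw [pow_succ', Module.End.mul_apply, ih, map_add, polyLaplacian_mul_X, map_smul,
      ← pderiv_polyLaplacian, ← Module.End.mul_apply, ← Module.End.mul_apply, ← pow_succ',
      ← pow_succ', ← Nat.cast_smul_eq_nsmul ℂ, add_assoc, ← add_smul]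
    congr 2
    push_cast
    ring

/-- The operator `∑ j < N, cʲ Δʲ / j!`, a truncation of the heat operator `exp (c Δ)`. -/
noncomputable def heatOperator (c : ℂ) (N : ℕ) :
    MvPolynomial (Fin n) ℂ →ₗ[ℂ] MvPolynomial (Fin n) ℂ :=
  ∑ j ∈ Finset.range N, (c ^ j / (j.factorial : ℂ)) • polyLaplacian n ^ j

lemma heatOperator_apply (c : ℂ) (N : ℕ) (p : MvPolynomial (Fin n) ℂ) :
    heatOperator c N p =
      ∑ j ∈ Finset.range N, (c ^ j / (j.factorial : ℂ)) • (polyLaplacian n ^ j) p := by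
  simp [heatOperator]

lemma heatOperator_succ_of_harmonic (c : ℂ) (N : ℕ) {p : MvPolynomial (Fin n) ℂ}
    (hp : polyLaplacian n p = 0) : heatOperator c (N + 1) p = p := by
  rw [heatOperator_apply, Finset.sum_range_succ', Finset.sum_eq_zero fun j _ ↦ ?_]
  · simp
  · rw [pow_succ (polyLaplacian n), Module.End.mul_apply, hp, map_zero, smul_zero]

/-- The commutation relation `exp (c Δ) Xᵢ = (Xᵢ + 2 c ∂ᵢ) exp (c Δ)`, in truncated form. -/
lemma heatOperator_succ_mul_X (c : ℂ) (N : ℕ) (i : Fin n) (p : MvPolynomial (Fin n) ℂ) :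
    heatOperator c (N + 1) (p * X i) =
      heatOperator c (N + 1) p * X i + (2 * c) • pderiv i (heatOperator c N p) := by
  simp only [heatOperator_apply, Finset.sum_range_succ' _ N, polyLaplacian_pow_succ_mul_X,
    smul_add, Finset.sum_add_distrib, map_sum, Finset.smul_sum, add_mul, Finset.sum_mul,
    Derivation.map_smul, smul_smul, smul_mul_assoc, pow_zero, Module.End.one_apply]
  rw [add_right_comm]
  congr 1
  refine Finset.sum_congr rfl fun j _ ↦ ?_
  congr 1
  have : (j.factorial : ℂ) ≠ 0 := by exact_mod_cast j.factorial_ne_zero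
  have : (j + 1 : ℂ) ≠ 0 := by exact_mod_cast j.succ_ne_zero
  rw [Nat.factorial_succ]
  push_cast
  field_simp
  ring

lemma hasDerivAt_eval {u : ℝ → Fin n → ℂ} {u' : Fin n → ℂ} {t : ℝ}
    (hu : ∀ j, HasDerivAt (fun s ↦ u s j) (u' j) t) (p : MvPolynomial (Fin n) ℂ) :
    HasDerivAt (fun s ↦ eval (u s) p) (∑ j, u' j * eval (u t) (pderiv j p)) t := by
  induction p using MvPolynomial.induction_on with
  | C a => simpa using hasDerivAt_const t a
  | add p q hp hq =>
    simpa [mul_add, Finset.sum_add_distrib] using! hp.add hq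
  | mul_X p i hp =>
    have := hp.mul (hu i)
    simp only [map_mul, eval_X]
    refine this.congr_deriv ?_
    have h (j : Fin n) : u' j * eval (u t) (pderiv j (p * X i)) =
        u' j * eval (u t) (pderiv j p) * u t i + if j = i then eval (u t) p * u' i else 0 := by
      by_cases hij : j = i
      · subst hij; simp; ring
      · simp [pderiv_X_of_ne (Ne.symm hij), hij]; ring
    simp only [h, Finset.sum_add_distrib, Finset.sum_mul, Finset.sum_ite_eq', Finset.mem_univ,
      if_true]

lemma eval_const_mul_of_isHomogeneous {k : ℕ} {p : MvPolynomial (Fin n) ℂ}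
    (hp : p.IsHomogeneous k) (c : ℂ) (v : Fin n → ℂ) :
    eval (fun j ↦ c * v j) p = c ^ k * eval v p := by
  rw [eval_eq', eval_eq', Finset.mul_sum]
  refine Finset.sum_congr rfl fun d hd ↦ ?_
  have h : ∑ i, d i = k := by
    simpa [Finsupp.weight_apply, Finsupp.sum_fintype] using hp (mem_support_iff.mp hd)
  simp only [mul_pow, Finset.prod_mul_distrib, Finset.prod_pow_eq_pow_sum, h]
  ring

end HeatOperator

/-! ### Fourier transforms of polynomials times Gaussians -/

section Gaussian

open FourierTransform

variable {n : ℕ}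

@[fun_prop]
lemma continuous_polyEval (p : MvPolynomial (Fin n) ℂ) : Continuous (polyEval p) := by
  unfold polyEval
  refine (MvPolynomial.continuous_eval p).comp ?_
  fun_prop

lemma polyEval_mul_X (p : MvPolynomial (Fin n) ℂ) (i : Fin n) (x : EuclideanSpace ℝ (Fin n)) :
    polyEval (p * MvPolynomial.X i) x = polyEval p x * x i := by
  simp [polyEval]

lemma exists_norm_polyEval_le (p : MvPolynomial (Fin n) ℂ) :
    ∃ (C : ℝ) (d : ℕ), 0 ≤ C ∧ ∀ x, ‖polyEval p x‖ ≤ C * (1 + ‖x‖) ^ d := by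
  induction p using MvPolynomial.induction_on with
  | C a => exact ⟨‖a‖, 0, norm_nonneg _, fun x ↦ by simp [polyEval]⟩
  | add p q hp hq =>
    obtain ⟨C, d, hC, hp⟩ := hp
    obtain ⟨C', d', hC', hq⟩ := hq
    refine ⟨C + C', max d d', by positivity, fun x ↦ ?_⟩
    have h1 : 1 ≤ 1 + ‖x‖ := by simp
    calc ‖polyEval (p + q) x‖ ≤ ‖polyEval p x‖ + ‖polyEval q x‖ := by
          simpa [polyEval] using norm_add_le _ _
      _ ≤ C * (1 + ‖x‖) ^ d + C' * (1 + ‖x‖) ^ d' := add_le_add (hp x) (hq x)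
      _ ≤ C * (1 + ‖x‖) ^ max d d' + C' * (1 + ‖x‖) ^ max d d' := by
          gcongr <;> simp
      _ = _ := by ring
  | mul_X p i hp =>
    obtain ⟨C, d, hC, hp⟩ := hp
    refine ⟨C, d + 1, hC, fun x ↦ ?_⟩
    rw [polyEval_mul_X, norm_mul, pow_succ, ← mul_assoc]
    refine mul_le_mul (hp x) ?_ (norm_nonneg _) (by positivity)
    have := PiLp.norm_apply_le x i
    simp only [Complex.norm_real]
    linarith

lemma exists_one_add_pow_mul_exp_le {β : ℝ} (hβ : 0 < β) (N : ℕ) :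
    ∃ C : ℝ, 0 ≤ C ∧ ∀ t : ℝ, 0 ≤ t → (1 + t) ^ N * Real.exp (-β * t ^ 2) ≤ C := by
  -- `(1 + t) ^ N ≤ N! exp (1 + t)`, and `t - β t² ≤ 1 / (4 β)` by completing the square
  refine ⟨N.factorial * Real.exp (1 + 1 / (4 * β)), by positivity, fun t ht ↦ ?_⟩
  have h1 : (1 + t) ^ N ≤ N.factorial * Real.exp (1 + t) := by
    have := Real.pow_div_factorial_le_exp (1 + t) (by positivity) N
    rwa [div_le_iff₀' (by positivity)] at this
  calc (1 + t) ^ N * Real.exp (-β * t ^ 2)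
      ≤ N.factorial * Real.exp (1 + t) * Real.exp (-β * t ^ 2) := by gcongr
    _ = N.factorial * Real.exp (1 + t + -β * t ^ 2) := by rw [mul_assoc, ← Real.exp_add]
    _ ≤ _ := by
      refine mul_le_mul_of_nonneg_left (Real.exp_le_exp.mpr ?_) (by positivity)
      have : 1 / (4 * β) + β * t ^ 2 - t = (1 - 2 * β * t) ^ 2 / (4 * β) := by
        field_simp; ring
      have h2 : 0 ≤ (1 - 2 * β * t) ^ 2 / (4 * β) := by positivity
      linarith

/-- A polynomial times a Gaussian decays faster than any power, locally uniformly in the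
parameter of the Gaussian. -/
lemma exists_norm_polyEval_mul_gaussian_le (p : MvPolynomial (Fin n) ℂ) {β : ℝ} (hβ : 0 < β)
    (N : ℕ) : ∃ C : ℝ, ∀ b : ℂ, β ≤ b.re → ∀ x : EuclideanSpace ℝ (Fin n),
      ‖polyEval p x * Complex.exp (-b * ‖x‖ ^ 2)‖ ≤ C * (1 + ‖x‖)⁻¹ ^ N := by
  obtain ⟨C, d, hC, hp⟩ := exists_norm_polyEval_le p
  obtain ⟨C', hC', h'⟩ := exists_one_add_pow_mul_exp_le hβ (d + N)
  refine ⟨C * C', fun b hb x ↦ ?_⟩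
  have he : ‖Complex.exp (-b * ‖x‖ ^ 2)‖ ≤ Real.exp (-β * ‖x‖ ^ 2) := by
    rw [Complex.norm_exp, Real.exp_le_exp, ← Complex.ofReal_pow, Complex.re_mul_ofReal,
      Complex.neg_re]
    nlinarith [sq_nonneg ‖x‖]
  have h1 : (1 + ‖x‖) ^ N ≠ 0 := by positivity
  rw [inv_pow, ← div_eq_mul_inv, le_div_iff₀ (by positivity), norm_mul]
  calc ‖polyEval p x‖ * ‖Complex.exp (-b * ‖x‖ ^ 2)‖ * (1 + ‖x‖) ^ N
      ≤ C * (1 + ‖x‖) ^ d * Real.exp (-β * ‖x‖ ^ 2) * (1 + ‖x‖) ^ N := by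
        gcongr; exact hp x
    _ = C * ((1 + ‖x‖) ^ (d + N) * Real.exp (-β * ‖x‖ ^ 2)) := by rw [pow_add]; ring
    _ ≤ C * C' := by gcongr; exact h' _ (norm_nonneg x)

lemma integrable_polyEval_mul_gaussian (p : MvPolynomial (Fin n) ℂ) {b : ℂ} (hb : 0 < b.re) :
    Integrable fun x : EuclideanSpace ℝ (Fin n) ↦ polyEval p x * Complex.exp (-b * ‖x‖ ^ 2) := by
  obtain ⟨C, hC⟩ := exists_norm_polyEval_mul_gaussian_le p hb (n + 1)
  refine Integrable.mono' (g := fun x ↦ C * (1 + ‖x‖) ^ (-((n + 1 : ℕ) : ℝ)))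
    ((integrable_one_add_norm (by simp)).const_mul C)
    (Continuous.aestronglyMeasurable (by fun_prop)) (ae_of_all _ fun x ↦ ?_)
  rw [Real.rpow_neg (by positivity), Real.rpow_natCast, ← inv_pow]
  exact hC b le_rfl x

lemma integrable_norm_mul_polyEval_mul_gaussian (p : MvPolynomial (Fin n) ℂ) {b : ℂ}
    (hb : 0 < b.re) : Integrable fun x : EuclideanSpace ℝ (Fin n) ↦
      ‖x‖ * ‖polyEval p x * Complex.exp (-b * ‖x‖ ^ 2)‖ := by
  obtain ⟨C, hC⟩ := exists_norm_polyEval_mul_gaussian_le p hb (n + 2)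
  refine Integrable.mono' (g := fun x ↦ C * (1 + ‖x‖) ^ (-((n + 1 : ℕ) : ℝ)))
    ((integrable_one_add_norm (by simp)).const_mul C)
    (Continuous.aestronglyMeasurable (by fun_prop)) (ae_of_all _ fun x ↦ ?_)
  rw [Real.rpow_neg (by positivity), Real.rpow_natCast, ← inv_pow, norm_mul, norm_norm, norm_norm]
  have h0 : 0 ≤ C * (1 + ‖x‖)⁻¹ ^ (n + 2) := (norm_nonneg _).trans (hC b le_rfl x)
  calc ‖x‖ * ‖polyEval p x * Complex.exp (-b * ‖x‖ ^ 2)‖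
      ≤ (1 + ‖x‖) * (C * (1 + ‖x‖)⁻¹ ^ (n + 2)) :=
        mul_le_mul (by simp) (hC b le_rfl x) (norm_nonneg _) (by positivity)
    _ = _ := by
        have : 1 + ‖x‖ ≠ 0 := by positivity
        rw [pow_succ]; field_simp

/-- Multiplication by a coordinate becomes differentiation under the Fourier transform. -/
lemma hasDerivAt_fourier_line {f : EuclideanSpace ℝ (Fin n) → ℂ} (hf : Integrable f)
    (hf' : Integrable fun x ↦ ‖x‖ * ‖f x‖) (ξ : EuclideanSpace ℝ (Fin n)) (i : Fin n) :
    HasDerivAt (fun t : ℝ ↦ 𝓕 f (ξ + t • EuclideanSpace.single i 1))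
      (-(2 * Real.pi * Complex.I) * 𝓕 (fun x ↦ f x * x i) ξ) 0 := by
  have h := Real.hasFDerivAt_fourier hf hf' ξ
  have hl : HasDerivAt (fun t : ℝ ↦ ξ + t • (EuclideanSpace.single i 1 : EuclideanSpace ℝ (Fin n)))
      (EuclideanSpace.single i 1) 0 := by
    simpa using ((hasDerivAt_id (0 : ℝ)).smul_const
      (EuclideanSpace.single i 1 : EuclideanSpace ℝ (Fin n))).const_add ξ
  have h2 : HasFDerivAt (𝓕 f) (𝓕 (VectorFourier.fourierSMulRight (innerSL ℝ) f) ξ)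
      (ξ + (0 : ℝ) • (EuclideanSpace.single i 1 : EuclideanSpace ℝ (Fin n))) := by simpa using h
  refine (h2.comp_hasDerivAt (0 : ℝ) hl).congr_deriv ?_
  have hint : Integrable (VectorFourier.fourierSMulRight (innerSL ℝ) f) := by
    refine Integrable.mono'
      (hf'.const_mul (2 * Real.pi * ‖innerSL ℝ (E := EuclideanSpace ℝ (Fin n))‖))
      hf.1.fourierSMulRight (ae_of_all _ fun v ↦ ?_)
    rw [← mul_assoc]
    exact VectorFourier.norm_fourierSMulRight_le _ _ _
  rw [Real.fourier_continuousLinearMap_apply hint, Real.fourier_eq, Real.fourier_eq,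
    ← integral_const_mul]
  refine integral_congr_ae (ae_of_all _ fun v ↦ ?_)
  have hv : innerSL ℝ v (EuclideanSpace.single i 1) = v i := by
    rw [innerSL_apply_apply, EuclideanSpace.inner_single_right]
    simp
  simp only [VectorFourier.fourierSMulRight_apply, hv, Circle.smul_def, smul_eq_mul,
    Complex.real_smul]
  ring

open MvPolynomial in
/-- The Fourier transform of a polynomial times a Gaussian: up to the factor expected for the
Gaussian itself, the polynomial is smoothed by the heat operator and evaluated at `-i π ξ / b`. -/
theorem exists_fourier_polyEval_mul_gaussian {b : ℂ} (hb : 0 < b.re)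
    (p : MvPolynomial (Fin n) ℂ) : ∃ N₀, ∀ N ≥ N₀, ∀ ξ : EuclideanSpace ℝ (Fin n),
      𝓕 (fun x : EuclideanSpace ℝ (Fin n) ↦ polyEval p x * Complex.exp (-b * ‖x‖ ^ 2)) ξ =
        (Real.pi / b) ^ (n / 2 : ℂ) *
          eval (fun j ↦ (-Complex.I * Real.pi / b) * ξ j) (heatOperator (1 / (4 * b)) N p) *
          Complex.exp (-Real.pi ^ 2 * ‖ξ‖ ^ 2 / b) := by
  have hb0 : b ≠ 0 := by rintro rfl; simp at hb
  have hpi : (Real.pi : ℂ) ≠ 0 := by exact_mod_cast Real.pi_ne_zero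
  induction p using MvPolynomial.induction_on with
  | C a =>
    refine ⟨1, fun N hN ξ ↦ ?_⟩
    obtain ⟨N, rfl⟩ := Nat.exists_eq_add_of_le' hN
    rw [heatOperator_succ_of_harmonic _ _ (by simp [polyLaplacian_apply])]
    have h := fourier_gaussian_innerProductSpace (V := EuclideanSpace ℝ (Fin n)) hb ξ
    rw [finrank_euclideanSpace_fin] at h
    simp only [polyEval, eval_C]
    rw [mul_right_comm, ← h, mul_comm, Real.fourier_eq, Real.fourier_eq, ← integral_const_mul]
    refine integral_congr_ae (ae_of_all _ fun v ↦ ?_)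
    simp only [Circle.smul_def, smul_eq_mul]
    ring
  | add p q hp hq =>
    obtain ⟨N₁, h₁⟩ := hp
    obtain ⟨N₂, h₂⟩ := hq
    refine ⟨max N₁ N₂, fun N hN ξ ↦ ?_⟩
    have e : (fun x : EuclideanSpace ℝ (Fin n) ↦
        polyEval (p + q) x * Complex.exp (-b * ‖x‖ ^ 2)) =
        (fun x ↦ polyEval p x * Complex.exp (-b * ‖x‖ ^ 2)) +
          fun x ↦ polyEval q x * Complex.exp (-b * ‖x‖ ^ 2) := by
      ext x; simp [polyEval, add_mul]
    rw [e, Real.fourier_eq, map_add, map_add, mul_add, add_mul,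
      ← h₁ N (le_of_max_le_left hN), ← h₂ N (le_of_max_le_right hN), Real.fourier_eq,
      Real.fourier_eq, ← integral_add]
    · simp only [Pi.add_apply, smul_add]
    · exact (Real.fourierIntegral_convergent_iff ξ).mpr (integrable_polyEval_mul_gaussian p hb)
    · exact (Real.fourierIntegral_convergent_iff ξ).mpr (integrable_polyEval_mul_gaussian q hb)
  | mul_X p i hp =>
    obtain ⟨N₀, h₀⟩ := hp
    refine ⟨N₀ + 1, fun N hN ξ ↦ ?_⟩
    obtain ⟨N, rfl⟩ := Nat.exists_eq_add_of_le' (le_trans (Nat.le_add_left 1 N₀) hN)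
    have hNN : N₀ ≤ N := by omega
    set s : ℂ := -Complex.I * Real.pi / b with hs
    set c : ℂ := 1 / (4 * b) with hc
    set K : ℂ := (Real.pi / b) ^ (n / 2 : ℂ) with hK
    have hK0 : K ≠ 0 := by
      rw [hK, Complex.cpow_ne_zero_iff]
      exact Or.inl (div_ne_zero hpi hb0)
    -- both truncations compute the Fourier transform for `p`, so they agree at `s • ξ`
    have htr : eval (fun j ↦ s * ξ j) (heatOperator c (N + 1) p) =
        eval (fun j ↦ s * ξ j) (heatOperator c N p) := by
      have := (h₀ (N + 1) (by omega) ξ).symm.trans (h₀ N hNN ξ)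
      exact mul_left_cancel₀ hK0 (mul_right_cancel₀ (Complex.exp_ne_zero _) this)
    have hD := hasDerivAt_fourier_line (integrable_polyEval_mul_gaussian p hb)
      (integrable_norm_mul_polyEval_mul_gaussian p hb) ξ i
    simp only [← mul_right_comm (polyEval p _), ← polyEval_mul_X] at hD
    have hcoord (j : Fin n) : HasDerivAt
        (fun t : ℝ ↦ s * (((ξ + t • EuclideanSpace.single i (1 : ℝ)) j : ℝ) : ℂ))
        (s * if j = i then 1 else 0) 0 := by
      have : HasDerivAt (fun t : ℝ ↦ ((ξ + t • EuclideanSpace.single i (1 : ℝ)) j : ℝ))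
          (if j = i then 1 else 0) 0 := by
        simpa [Pi.single_apply] using
          ((hasDerivAt_id (0 : ℝ)).mul_const (if j = i then (1 : ℝ) else 0)).const_add (ξ j)
      have h := this.ofReal_comp.const_mul s
      refine h.congr_deriv ?_
      split_ifs <;> simp
    have hP := hasDerivAt_eval hcoord (heatOperator c N p)
    have hnorm : HasDerivAt (fun t : ℝ ↦ (‖ξ + t • EuclideanSpace.single i (1 : ℝ)‖ : ℂ) ^ 2)
        (2 * ξ i) 0 := by
      have e (t : ℝ) : ‖ξ + t • EuclideanSpace.single i (1 : ℝ)‖ ^ 2 =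
          ‖ξ‖ ^ 2 + 2 * ξ i * t + t ^ 2 := by
        rw [norm_add_sq_real, inner_smul_right, EuclideanSpace.inner_single_right, norm_smul]
        simp
        ring
      have h : HasDerivAt (fun t : ℝ ↦ ‖ξ‖ ^ 2 + 2 * ξ i * t + t ^ 2) (2 * ξ i) 0 := by
        have := (((hasDerivAt_id (0 : ℝ)).const_mul (2 * ξ i)).const_add (‖ξ‖ ^ 2)).add
          (hasDerivAt_pow 2 (0 : ℝ))
        simpa using! this
      have h := h.ofReal_comp
      simp only [← e] at h
      simpa using h
    have hE := ((hnorm.const_mul (-(Real.pi : ℂ) ^ 2)).div_const b).cexp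
    have hR := (hP.const_mul K).fun_mul hE
    have hfun := funext fun t : ℝ ↦ h₀ N hNN (ξ + t • EuclideanSpace.single i (1 : ℝ))
    rw [hfun] at hD
    have hu := hD.unique hR
    simp only [zero_smul, add_zero, mul_ite, mul_one, mul_zero, ite_mul, zero_mul,
      Finset.sum_ite_eq', Finset.mem_univ, if_true] at hu
    rw [heatOperator_succ_mul_X, map_add, map_mul, eval_X, htr, smul_eval]
    refine mul_left_cancel₀ (a := -(2 * Real.pi * Complex.I)) (by simp [hpi]) (hu.trans ?_)
    have hI : Complex.I ^ 2 = -1 := Complex.I_sq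
    generalize eval (fun j ↦ s * ξ j) (pderiv i (heatOperator c N p)) = A
    generalize eval (fun j ↦ s * ξ j) (heatOperator c N p) = B
    generalize Complex.exp (-Real.pi ^ 2 * ‖ξ‖ ^ 2 / b) = e
    rw [hs, hc]
    field_simp
    ring_nf
    rw [hI]
    ring

/-- The Fourier transform of a homogeneous harmonic polynomial times a Gaussian: the heat operator
fixes the polynomial, so only a power of `-i π / b` and the Gaussian factor appear. -/
theorem fourier_harmonicPoly_mul_gaussian {b : ℂ} (hb : 0 < b.re) {k : ℕ}
    {p : MvPolynomial (Fin n) ℂ} (hp : p ∈ harmonicPoly n k) (ξ : EuclideanSpace ℝ (Fin n)) :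
    𝓕 (fun x : EuclideanSpace ℝ (Fin n) ↦ polyEval p x * Complex.exp (-b * ‖x‖ ^ 2)) ξ =
      (Real.pi / b) ^ (n / 2 : ℂ) * ((-Complex.I * Real.pi / b) ^ k * polyEval p ξ) *
        Complex.exp (-Real.pi ^ 2 * ‖ξ‖ ^ 2 / b) := by
  obtain ⟨hp1, hp2⟩ := hp
  obtain ⟨N, hN⟩ := exists_fourier_polyEval_mul_gaussian hb p
  rw [hN (N + 1) (by omega) ξ, heatOperator_succ_of_harmonic _ _ (LinearMap.mem_ker.mp hp2)]
  rw [eval_const_mul_of_isHomogeneous ((MvPolynomial.mem_homogeneousSubmodule k p).mp hp1)]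
  rfl

end Gaussian

/-! ### Even unimodular lattices -/

section Lattice

open FourierTransform

variable {n : ℕ} {L : Submodule ℤ (EuclideanSpace ℝ (Fin n))}

lemma IsEvenUnimodular.mem_iff (hL : IsEvenUnimodular L) (y : EuclideanSpace ℝ (Fin n)) :
    y ∈ L ↔ ∀ x ∈ L, ∃ k : ℤ, inner ℝ x y = (k : ℝ) := by
  conv_lhs => rw [← hL.dual_eq, LinearMap.BilinForm.mem_dualSubmodule]
  refine forall₂_congr fun x _ ↦ ?_
  rw [Submodule.mem_one, innerₗ_apply_apply, real_inner_comm]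
  exact ⟨fun ⟨k, hk⟩ ↦ ⟨k, hk.symm⟩, fun ⟨k, hk⟩ ↦ ⟨k, hk.symm⟩⟩

lemma IsEvenUnimodular.isZLattice (hL : IsEvenUnimodular L) [DiscreteTopology L] :
    IsZLattice ℝ L :=
  ⟨hL.span_eq_top⟩

lemma IsEvenUnimodular.exists_norm_sq (hL : IsEvenUnimodular L) (x : L) :
    ∃ m : ℕ, inner ℝ (x : EuclideanSpace ℝ (Fin n)) x = 2 * (m : ℝ) := by
  obtain ⟨k, hk⟩ := hL.even x x.2
  have h0 : (0 : ℝ) ≤ 2 * (k : ℝ) := hk ▸ real_inner_self_nonneg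
  have : 0 ≤ k := by exact_mod_cast (by linarith : (0 : ℝ) ≤ k)
  obtain ⟨m, rfl⟩ := Int.eq_ofNat_of_zero_le this
  exact ⟨m, by simpa using hk⟩

lemma IsEvenUnimodular.finite_shell (hL : IsEvenUnimodular L) (m : ℕ) : (shell L m).Finite := by
  have := hL.discrete
  have hcl : IsClosed (L : Set (EuclideanSpace ℝ (Fin n))) :=
    @AddSubgroup.isClosed_of_discrete _ _ _ _ _ L.toAddSubgroup
      (inferInstanceAs (DiscreteTopology L))
  refine ((Metric.finite_isBounded_inter_isClosed DiscreteTopology.isDiscrete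
    (Metric.isBounded_closedBall (x := 0) (r := √m)) hcl)).subset fun x hx ↦ ⟨?_, hx.1⟩
  rw [mem_closedBall_zero_iff, ← hx.2, real_inner_self_eq_norm_sq, Real.sqrt_sq (norm_nonneg x)]

/-- Poisson summation for a unimodular lattice. The covolume is one, as the self-dual Gaussian
`exp (-π ‖x‖²)` shows. -/
theorem IsEvenUnimodular.poisson_summation (hL : IsEvenUnimodular L)
    {f : EuclideanSpace ℝ (Fin n) → ℂ} {C : ℝ} {N : ℕ} (hf : Continuous f) (hN : n < N)
    (hC : ∀ x, ‖f x‖ ≤ C * (1 + ‖x‖)⁻¹ ^ N) (hs : Summable fun y : L ↦ 𝓕 f y) :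
    ∑' x : L, f x = ∑' y : L, 𝓕 f y := by
  have := hL.discrete
  have := hL.isZLattice
  obtain ⟨c, hc0, hc⟩ := exists_poisson_summation L L hL.mem_iff
  let g : EuclideanSpace ℝ (Fin n) → ℂ := fun x ↦ polyEval 1 x * Complex.exp (-Real.pi * ‖x‖ ^ 2)
  have hpi : 0 < (Real.pi : ℂ).re := by simpa using Real.pi_pos
  have hpi0 : (Real.pi : ℂ) ≠ 0 := by exact_mod_cast Real.pi_ne_zero
  have hgg (y : EuclideanSpace ℝ (Fin n)) : 𝓕 g y = g y := by
    have h1 : (1 : MvPolynomial (Fin n) ℂ) ∈ harmonicPoly n 0 :=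
      ⟨MvPolynomial.isHomogeneous_one _ _, by simp [polyLaplacian_apply]⟩
    rw [fourier_harmonicPoly_mul_gaussian hpi h1]
    simp only [g, div_self hpi0, Complex.one_cpow, pow_zero, one_mul]
    congr 2
    field_simp
  have hgr (x : EuclideanSpace ℝ (Fin n)) : g x = (Real.exp (-Real.pi * ‖x‖ ^ 2) : ℝ) := by
    simp [g, polyEval]
  obtain ⟨C', hC'⟩ := exists_norm_polyEval_mul_gaussian_le (n := n) 1 Real.pi_pos (n + 1)
  have hgC : ∀ x, ‖g x‖ ≤ C' * (1 + ‖x‖)⁻¹ ^ (n + 1) := hC' Real.pi (by simp)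
  have hgs : Summable fun x : L ↦ g x :=
    Summable.of_norm_bounded ((ZLattice.summable_one_add_norm_inv_pow L
      (by simp)).mul_left C') fun x ↦ hgC x
  have key := hc g C' (n + 1) (by fun_prop) (by simp) hgC (by simpa only [hgg] using hgs)
  simp only [hgg] at key
  have hne : ∑' x : L, g x ≠ 0 := by
    have hgs' : Summable fun x : L ↦
        Real.exp (-Real.pi * ‖(x : EuclideanSpace ℝ (Fin n))‖ ^ 2) := by
      simp only [hgr] at hgs
      exact Complex.summable_ofReal.mp hgs
    simp only [hgr]
    rw [← Complex.ofReal_tsum]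
    exact_mod_cast (hgs'.tsum_pos (fun _ ↦ (Real.exp_pos _).le) 0 (Real.exp_pos _)).ne'
  have hc1 : (c : ℂ) = 1 := by
    have : (c - 1 : ℂ) * ∑' x : L, g x = 0 := by rw [sub_mul, one_mul, ← key, sub_self]
    exact sub_eq_zero.mp ((mul_eq_zero.mp this).resolve_right hne)
  rw [hc f C N hf (by simpa using hN) hC hs, hc1, one_mul]

end Lattice

/-! ### Theta series with polynomial coefficients -/

section Theta

variable {n : ℕ} (L : Submodule ℤ (EuclideanSpace ℝ (Fin n)))

/-- The theta series of `L` with polynomial coefficient `p`, as a function on `ℂ`; it is meaningful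
in the upper half-plane only. -/
noncomputable def thetaSeries (p : MvPolynomial (Fin n) ℂ) (z : ℂ) : ℂ :=
  ∑' x : L, polyEval p x * Complex.exp (Real.pi * Complex.I * z * ((inner ℝ
    (x : EuclideanSpace ℝ (Fin n)) (x : EuclideanSpace ℝ (Fin n)) : ℝ) : ℂ))

/-- The sum of the values of `p` on the shell of norm `2 m`: the coefficient of the theta series
at `exp (2 π i m z)`. -/
noncomputable def thetaCoeff (p : MvPolynomial (Fin n) ℂ) (m : ℕ) : ℂ :=
  ∑ᶠ x ∈ shell L (2 * m), polyEval p x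

lemma theta_exp_eq (z : ℂ) (x : EuclideanSpace ℝ (Fin n)) :
    Complex.exp (Real.pi * Complex.I * z * ((inner ℝ x x : ℝ) : ℂ)) =
      Complex.exp (-(-(Real.pi * Complex.I * z)) * ‖x‖ ^ 2) := by
  rw [real_inner_self_eq_norm_sq, neg_neg, Complex.ofReal_pow]

lemma re_neg_pi_mul_I_mul (z : ℂ) : (-(Real.pi * Complex.I * z)).re = Real.pi * z.im := by
  simp [Complex.mul_re]

variable {L}

/-- The theta series is dominated, uniformly on the half-planes `δ ≤ Im z`. -/
lemma IsEvenUnimodular.exists_summable_bound (hL : IsEvenUnimodular L)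
    (p : MvPolynomial (Fin n) ℂ) {δ : ℝ} (hδ : 0 < δ) : ∃ u : L → ℝ, Summable u ∧
      ∀ (x : L) (z : ℂ), δ ≤ z.im → ‖polyEval p x * Complex.exp (Real.pi * Complex.I * z *
        ((inner ℝ (x : EuclideanSpace ℝ (Fin n)) (x : EuclideanSpace ℝ (Fin n)) : ℝ) : ℂ))‖ ≤
          u x := by
  have := hL.discrete
  have := hL.isZLattice
  obtain ⟨C, hC⟩ := exists_norm_polyEval_mul_gaussian_le p (mul_pos Real.pi_pos hδ) (n + 1)
  refine ⟨_, (ZLattice.summable_one_add_norm_inv_pow L (N := n + 1) (by simp)).mul_left C,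
    fun x z hz ↦ ?_⟩
  rw [theta_exp_eq]
  refine hC _ ?_ x
  rw [re_neg_pi_mul_I_mul]
  exact mul_le_mul_of_nonneg_left hz Real.pi_pos.le

lemma IsEvenUnimodular.hasSum_thetaSeries (hL : IsEvenUnimodular L)
    (p : MvPolynomial (Fin n) ℂ) {z : ℂ} (hz : 0 < z.im) :
    HasSum (fun x : L ↦ polyEval p x * Complex.exp (Real.pi * Complex.I * z * ((inner ℝ
      (x : EuclideanSpace ℝ (Fin n)) (x : EuclideanSpace ℝ (Fin n)) : ℝ) : ℂ)))
      (thetaSeries L p z) := by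
  obtain ⟨u, hu, h⟩ := hL.exists_summable_bound p hz
  exact (Summable.of_norm_bounded hu fun x ↦ h x z le_rfl).hasSum

lemma IsEvenUnimodular.differentiableOn_thetaSeries (hL : IsEvenUnimodular L)
    (p : MvPolynomial (Fin n) ℂ) : DifferentiableOn ℂ (thetaSeries L p) {z | 0 < z.im} := by
  intro z hz
  obtain ⟨u, hu, h⟩ := hL.exists_summable_bound p (half_pos hz)
  have hopen : IsOpen {w : ℂ | z.im / 2 < w.im} := isOpen_lt continuous_const Complex.continuous_im
  have := Complex.differentiableOn_tsum_of_summable_norm hu (U := {w : ℂ | z.im / 2 < w.im})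
    (fun x ↦ (by fun_prop)) hopen fun x w hw ↦ h x w (le_of_lt hw)
  have hz' : z ∈ {w : ℂ | z.im / 2 < w.im} := half_lt_self (a := z.im) hz
  exact (this.differentiableAt (hopen.mem_nhds hz')).differentiableWithinAt

lemma IsEvenUnimodular.hasSum_thetaCoeff (hL : IsEvenUnimodular L)
    (p : MvPolynomial (Fin n) ℂ) (z : ℍ) :
    HasSum (fun m ↦ thetaCoeff L p m • Function.Periodic.qParam 1 (z : ℂ) ^ m)
      (thetaSeries L p z) := by
  choose g hg using hL.exists_norm_sq
  have h := (hL.hasSum_thetaSeries p z.im_pos).tsum_fiberwise g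
  refine h.congr_fun fun m ↦ ?_
  let e : shell L (2 * m) ≃ g ⁻¹' {m} :=
    { toFun x := ⟨⟨x, x.2.1⟩, by
        have h1 := hg ⟨x, x.2.1⟩
        have h2 := x.2.2.symm.trans h1
        push_cast at h2
        have : (m : ℝ) = g ⟨x, x.2.1⟩ := by linarith
        exact (by exact_mod_cast this.symm : g ⟨x, x.2.1⟩ = m)⟩
      invFun x := ⟨x.1, x.1.2, by
        rw [hg, show g x.1 = m from x.2]; push_cast; ring⟩
      left_inv x := rfl
      right_inv x := rfl }
  rw [← e.tsum_eq]
  have hq (x : shell L (2 * m)) : Complex.exp (Real.pi * Complex.I * (z : ℂ) * ((inner ℝ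
      (x : EuclideanSpace ℝ (Fin n)) (x : EuclideanSpace ℝ (Fin n)) : ℝ) : ℂ)) =
      Function.Periodic.qParam 1 (z : ℂ) ^ m := by
    rw [x.2.2, Function.Periodic.qParam, ← Complex.exp_nat_mul]
    congr 1
    push_cast
    ring
  change thetaCoeff L p m • _ = ∑' x : shell L (2 * m), polyEval p x * Complex.exp (_ * ((inner ℝ
      (x : EuclideanSpace ℝ (Fin n)) (x : EuclideanSpace ℝ (Fin n)) : ℝ) : ℂ))
  have := (hL.finite_shell (2 * m)).fintype
  simp only [hq, tsum_mul_right]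
  rw [tsum_fintype, smul_eq_mul, thetaCoeff, ← finsum_set_coe_eq_finsum_mem,
    finsum_eq_sum_of_fintype]

end Theta

/-! ### Modularity of the theta series -/

section Modularity

open FourierTransform

open UpperHalfPlane ModularForm ModularGroup
open scoped MatrixGroups

variable {L : Submodule ℤ (EuclideanSpace ℝ (Fin 24))}

/-- The transformation of the theta series under `z ↦ -1 / z`, by Poisson summation. -/
lemma IsEvenUnimodular.thetaSeries_neg_inv (hL : IsEvenUnimodular L) {k : ℕ}
    {p : MvPolynomial (Fin 24) ℂ} (hp : p ∈ harmonicPoly 24 k) {z : ℂ} (hz : 0 < z.im) :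
    thetaSeries L p (-z)⁻¹ = z ^ (12 + k) * thetaSeries L p z := by
  have hz0 : z ≠ 0 := by rintro rfl; simp at hz
  have hpi : (Real.pi : ℂ) ≠ 0 := by exact_mod_cast Real.pi_ne_zero
  have hI : Complex.I ≠ 0 := Complex.I_ne_zero
  have hz' : 0 < ((-z)⁻¹).im := by
    rw [Complex.inv_im, Complex.neg_im, neg_neg, Complex.normSq_neg]
    exact div_pos hz (Complex.normSq_pos.mpr hz0)
  set b : ℂ := -(Real.pi * Complex.I * z) with hbdef
  have hb : 0 < b.re := by rw [re_neg_pi_mul_I_mul]; exact mul_pos Real.pi_pos hz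
  have h1 : -Complex.I * Real.pi / b = z⁻¹ := by rw [hbdef]; field_simp
  have h2 : (Real.pi / b : ℂ) ^ ((24 : ℕ) / 2 : ℂ) = (z ^ 12)⁻¹ := by
    have e : (Real.pi / b : ℂ) = Complex.I * z⁻¹ := by
      rw [hbdef]; field_simp; rw [Complex.I_sq]
    rw [show ((24 : ℕ) / 2 : ℂ) = (12 : ℕ) by norm_num, Complex.cpow_natCast, e, mul_pow,
      show (12 : ℕ) = 4 * 3 by rfl, pow_mul Complex.I, Complex.I_pow_four, inv_pow]
    simp
  have h3 : -(Real.pi : ℂ) ^ 2 / b = Real.pi * Complex.I * (-z)⁻¹ := by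
    rw [hbdef]; field_simp; rw [Complex.I_sq, neg_neg]
  let f : EuclideanSpace ℝ (Fin 24) → ℂ := fun x ↦ polyEval p x * Complex.exp (-b * ‖x‖ ^ 2)
  have hF (y : EuclideanSpace ℝ (Fin 24)) : 𝓕 f y = (z ^ (12 + k))⁻¹ * (polyEval p y *
      Complex.exp (Real.pi * Complex.I * (-z)⁻¹ * ((inner ℝ y y : ℝ) : ℂ))) := by
    rw [fourier_harmonicPoly_mul_gaussian hb hp, h2, h1, mul_div_right_comm, h3,
      real_inner_self_eq_norm_sq, Complex.ofReal_pow, pow_add, mul_inv, inv_pow]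
    ring
  obtain ⟨C, hC⟩ := exists_norm_polyEval_mul_gaussian_le p hb 25
  have hs := (hL.hasSum_thetaSeries p hz').mul_left (z ^ (12 + k))⁻¹
  simp only [← hF] at hs
  have key := hL.poisson_summation (f := f) (by fun_prop) (by norm_num) (hC b le_rfl) hs.summable
  rw [hs.tsum_eq] at key
  have : thetaSeries L p z = ∑' x : L, f x := by simp only [thetaSeries, theta_exp_eq, f, hbdef]
  rw [this, key, mul_inv_cancel_left₀ (pow_ne_zero _ hz0)]

lemma IsEvenUnimodular.thetaSeries_add_one (hL : IsEvenUnimodular L)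
    (p : MvPolynomial (Fin 24) ℂ) (z : ℂ) : thetaSeries L p (1 + z) = thetaSeries L p z := by
  refine tsum_congr fun x ↦ ?_
  congr 1
  obtain ⟨m, hm⟩ := hL.exists_norm_sq x
  rw [hm]
  refine Complex.exp_eq_exp_iff_exists_int.mpr ⟨m, ?_⟩
  push_cast
  ring

/-- The theta series of an even unimodular lattice of rank 24, with a harmonic coefficient of
degree `k`, as a modular form of level one and weight `12 + k`. -/
noncomputable def IsEvenUnimodular.thetaForm (hL : IsEvenUnimodular L) {k : ℕ}
    {p : MvPolynomial (Fin 24) ℂ} (hp : p ∈ harmonicPoly 24 k) :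
    ModularForm 𝒮ℒ ((12 + k : ℕ) : ℤ) := by
  have hslash : ∀ γ : Matrix.SpecialLinearGroup (Fin 2) ℤ,
      (fun z : ℍ ↦ thetaSeries L p z) ∣[((12 + k : ℕ) : ℤ)] γ = fun z : ℍ ↦ thetaSeries L p z := by
    refine SlashInvariantForm.slash_action_generators_SL2Z ?_ ?_
    · ext z
      have hz0 : (z : ℂ) ≠ 0 := z.ne_zero
      rw [SL_slash_apply, modular_S_smul, ModularGroup.denom_S, zpow_neg, zpow_natCast]
      change thetaSeries L p (-(z : ℂ))⁻¹ * _ = _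
      rw [hL.thetaSeries_neg_inv hp z.im_pos]
      field_simp
    · ext z
      rw [SL_slash_apply, modular_T_smul]
      have : denom (Matrix.SpecialLinearGroup.toGL
        ((Matrix.SpecialLinearGroup.map (Int.castRingHom ℝ)) T)) (z : ℂ) = 1 :=
        (ModularGroup.denom_apply T z).trans (by simp [T])
      rw [this, one_zpow, mul_one, coe_vadd]
      simpa using hL.thetaSeries_add_one p z
  exact
    { toFun z := thetaSeries L p z
      slash_action_eq' := fun _ ⟨γ, hγ⟩ ↦ hγ ▸ hslash γ
      holo' := by
        rw [UpperHalfPlane.mdifferentiable_iff]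
        refine (hL.differentiableOn_thetaSeries p).congr fun z hz ↦ ?_
        simp [ofComplex_apply_of_im_pos hz]
      bdd_at_cusps' {c} hc := by
        rw [Subgroup.IsArithmetic.isCusp_iff_isCusp_SL2Z] at hc
        rw [OnePoint.isBoundedAt_iff_forall_SL2Z hc]
        intro γ _
        rw [show (_ : ℍ → ℂ) ∣[_] γ = _ from hslash γ]
        exact isBoundedAtImInfty_of_hasSum_qExpansion one_pos (hL.hasSum_thetaCoeff p) }

lemma IsEvenUnimodular.qExpansion_thetaForm_coeff (hL : IsEvenUnimodular L) {k : ℕ}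
    {p : MvPolynomial (Fin 24) ℂ} (hp : p ∈ harmonicPoly 24 k) (m : ℕ) :
    (qExpansion 1 (hL.thetaForm hp)).coeff m = thetaCoeff L p m :=
  (ModularFormClass.qExpansion_coeff_unique one_pos one_mem_strictPeriods_SL
    (f := hL.thetaForm hp) (hL.hasSum_thetaCoeff p) m).symm

end Modularity

/-! ### Modular forms of level one -/

section LevelOne

open UpperHalfPlane ModularForm EisensteinSeries
open scoped MatrixGroups

/-- The coefficients of `f` in degrees `0, …, 5` are `a₀, …, a₅`. In the theta series of an even
lattice these degrees belong to the shells of norms `0, 2, …, 10`. -/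
structure HasCoeffs (f : PowerSeries ℂ) (a₀ a₁ a₂ a₃ a₄ a₅ : ℂ) : Prop where
  coeff_zero : f.coeff 0 = a₀
  coeff_one : f.coeff 1 = a₁
  coeff_two : f.coeff 2 = a₂
  coeff_three : f.coeff 3 = a₃
  coeff_four : f.coeff 4 = a₄
  coeff_five : f.coeff 5 = a₅

lemma HasCoeffs.mul {f g : PowerSeries ℂ} {a₀ a₁ a₂ a₃ a₄ a₅ b₀ b₁ b₂ b₃ b₄ b₅ : ℂ}
    (hf : HasCoeffs f a₀ a₁ a₂ a₃ a₄ a₅) (hg : HasCoeffs g b₀ b₁ b₂ b₃ b₄ b₅) :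
    HasCoeffs (f * g) (a₀ * b₀) (a₀ * b₁ + a₁ * b₀) (a₀ * b₂ + a₁ * b₁ + a₂ * b₀)
      (a₀ * b₃ + a₁ * b₂ + a₂ * b₁ + a₃ * b₀)
      (a₀ * b₄ + a₁ * b₃ + a₂ * b₂ + a₃ * b₁ + a₄ * b₀)
      (a₀ * b₅ + a₁ * b₄ + a₂ * b₃ + a₃ * b₂ + a₄ * b₁ + a₅ * b₀) := by
  obtain ⟨f0, f1, f2, f3, f4, f5⟩ := hf
  obtain ⟨g0, g1, g2, g3, g4, g5⟩ := hg
  constructor <;>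
  simp only [PowerSeries.coeff_mul, Finset.Nat.sum_antidiagonal_eq_sum_range_succ
    (fun i j ↦ PowerSeries.coeff i f * PowerSeries.coeff j g), Finset.sum_range_succ,
    Finset.sum_range_zero, zero_add, f0, f1, f2, f3, f4, f5, g0, g1, g2, g3, g4, g5,
    Nat.sub_self, Nat.sub_zero, Nat.reduceSub]

lemma HasCoeffs.sub {f g : PowerSeries ℂ} {a₀ a₁ a₂ a₃ a₄ a₅ b₀ b₁ b₂ b₃ b₄ b₅ : ℂ}
    (hf : HasCoeffs f a₀ a₁ a₂ a₃ a₄ a₅) (hg : HasCoeffs g b₀ b₁ b₂ b₃ b₄ b₅) :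
    HasCoeffs (f - g) (a₀ - b₀) (a₁ - b₁) (a₂ - b₂) (a₃ - b₃) (a₄ - b₄) (a₅ - b₅) := by
  obtain ⟨f0, f1, f2, f3, f4, f5⟩ := hf
  obtain ⟨g0, g1, g2, g3, g4, g5⟩ := hg
  constructor <;> simp only [map_sub, *]

lemma HasCoeffs.smul {f : PowerSeries ℂ} {a₀ a₁ a₂ a₃ a₄ a₅ : ℂ} (c : ℂ)
    (hf : HasCoeffs f a₀ a₁ a₂ a₃ a₄ a₅) :
    HasCoeffs (c • f) (c * a₀) (c * a₁) (c * a₂) (c * a₃) (c * a₄) (c * a₅) := by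
  obtain ⟨f0, f1, f2, f3, f4, f5⟩ := hf
  constructor <;> simp only [PowerSeries.coeff_smul, smul_eq_mul, *]

lemma hasCoeffs_E₄ : HasCoeffs (qExpansion 1 E₄) 1 240 2160 6720 17520 30240 := by
  have h (m : ℕ) := E_qExpansion_coeff (k := 4) (by norm_num) ⟨2, rfl⟩ m
  rw [show bernoulli 4 = -1 / 30 by decide +kernel] at h
  have s1 : ArithmeticFunction.sigma 3 1 = 1 := by decide +kernel
  have s2 : ArithmeticFunction.sigma 3 2 = 9 := by decide +kernel
  have s3 : ArithmeticFunction.sigma 3 3 = 28 := by decide +kernel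
  have s4 : ArithmeticFunction.sigma 3 4 = 73 := by decide +kernel
  have s5 : ArithmeticFunction.sigma 3 5 = 126 := by decide +kernel
  constructor <;> rw [h] <;> norm_num [s1, s2, s3, s4, s5]

lemma hasCoeffs_E₆ :
    HasCoeffs (qExpansion 1 E₆) 1 (-504) (-16632) (-122976) (-532728) (-1575504) := by
  have h (m : ℕ) := E_qExpansion_coeff (k := 6) (by norm_num) ⟨3, rfl⟩ m
  rw [show bernoulli 6 = 1 / 42 by decide +kernel] at h
  have s1 : ArithmeticFunction.sigma 5 1 = 1 := by decide +kernel
  have s2 : ArithmeticFunction.sigma 5 2 = 33 := by decide +kernel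
  have s3 : ArithmeticFunction.sigma 5 3 = 244 := by decide +kernel
  have s4 : ArithmeticFunction.sigma 5 4 = 1057 := by decide +kernel
  have s5 : ArithmeticFunction.sigma 5 5 = 3126 := by decide +kernel
  constructor <;> rw [h] <;> norm_num [s1, s2, s3, s4, s5]

/-- `E₄³` as a modular form of weight 12. -/
noncomputable def E₄CubeForm : ModularForm 𝒮ℒ 12 := ModularForm.mcast (by norm_num) (E₄.pow 3)

/-- `E₆²` as a modular form of weight 12. -/
noncomputable def E₆SqForm : ModularForm 𝒮ℒ 12 := ModularForm.mcast (by norm_num) (E₆.pow 2)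

lemma E₄CubeForm_apply (z : ℍ) : E₄CubeForm z = E₄ z ^ 3 := congr_fun (coe_pow E₄ 3) z

lemma E₆SqForm_apply (z : ℍ) : E₆SqForm z = E₆ z ^ 2 := congr_fun (coe_pow E₆ 2) z

/-- The discriminant as a modular form, written in terms of the Eisenstein series, which gives
access to the coefficients of its `q`-expansion. -/
noncomputable def discriminantForm : ModularForm 𝒮ℒ 12 :=
  (1 / 1728 : ℂ) • (E₄CubeForm - E₆SqForm)

lemma discriminantForm_apply (z : ℍ) : discriminantForm z = discriminant z := by
  rw [discriminant_eq_E₄_cube_sub_E₆_sq]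
  simp [discriminantForm, E₄CubeForm_apply, E₆SqForm_apply]
  ring

lemma hasCoeffs_E₄Cube :
    HasCoeffs (qExpansion 1 E₄CubeForm) 1 720 179280 16954560 396974160 4632858720 := by
  have h := (hasCoeffs_E₄.mul hasCoeffs_E₄).mul hasCoeffs_E₄
  rw [← pow_two, ← pow_succ, ← ModularForm.qExpansion_pow one_pos one_mem_strictPeriods_SL] at h
  norm_num at h
  exact h

lemma hasCoeffs_discriminant :
    HasCoeffs (qExpansion 1 discriminantForm) 0 1 (-24) 252 (-1472) 4830 := by
  have h6 := hasCoeffs_E₆.mul hasCoeffs_E₆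
  rw [← pow_two, ← ModularForm.qExpansion_pow one_pos one_mem_strictPeriods_SL] at h6
  have h := (hasCoeffs_E₄Cube.sub h6).smul (1 / 1728)
  rw [discriminantForm, FunLike.coe_smul,
    ModularForm.qExpansion_smul one_pos one_mem_strictPeriods_SL, FunLike.coe_sub,
    ModularForm.qExpansion_sub one_pos one_mem_strictPeriods_SL]
  norm_num at h
  norm_num
  exact h

/-- `Δ²` as a modular form of weight 24. -/
noncomputable def discriminantSqForm : ModularForm 𝒮ℒ 24 := discriminantForm.mul discriminantForm

/-- `E₄ Δ²` as a modular form of weight 28. -/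
noncomputable def E₄DiscriminantSqForm : ModularForm 𝒮ℒ 28 := E₄.mul discriminantSqForm

/-- `E₆ Δ²` as a modular form of weight 30. -/
noncomputable def E₆DiscriminantSqForm : ModularForm 𝒮ℒ 30 := E₆.mul discriminantSqForm

lemma hasCoeffs_discriminantSq :
    HasCoeffs (qExpansion 1 discriminantSqForm) 0 0 1 (-48) 1080 (-15040) := by
  have h := hasCoeffs_discriminant.mul hasCoeffs_discriminant
  rw [← ModularForm.qExpansion_mul one_pos one_mem_strictPeriods_SL] at h
  norm_num at h
  exact h

lemma hasCoeffs_E₄DiscriminantSq :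
    HasCoeffs (qExpansion 1 E₄DiscriminantSqForm) 0 0 1 192 (-8280) 147200 := by
  have h := hasCoeffs_E₄.mul hasCoeffs_discriminantSq
  rw [← ModularForm.qExpansion_mul one_pos one_mem_strictPeriods_SL] at h
  norm_num at h
  exact h

lemma hasCoeffs_E₆DiscriminantSq :
    HasCoeffs (qExpansion 1 E₆DiscriminantSqForm) 0 0 1 (-552) 8640 116000 := by
  have h := hasCoeffs_E₆.mul hasCoeffs_discriminantSq
  rw [← ModularForm.qExpansion_mul one_pos one_mem_strictPeriods_SL] at h
  norm_num at h
  exact h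

/-- Modular forms of level one are determined by their `q`-expansion up to degree `k / 12`. -/
lemma levelOne_ext {k : ℤ} {f g : ModularForm 𝒮ℒ k}
    (h : ∀ m ≤ k.toNat / 12, (qExpansion 1 f).coeff m = (qExpansion 1 g).coeff m) : f = g := by
  rw [← sub_eq_zero]
  refine sturm_bound_levelOne ?_
  refine lt_of_lt_of_le (b := ((k.toNat / 12 + 1 : ℕ) : ℕ∞)) (by exact_mod_cast Nat.lt_succ_self _)
    (PowerSeries.nat_le_order _ _ fun m hm ↦ ?_)
  rw [FunLike.coe_sub, ModularForm.qExpansion_sub one_pos one_mem_strictPeriods_SL, map_sub,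
    h m (by omega), sub_self]

/-- A form of weight 26 that vanishes to order two at infinity is `Δ²` times a form of weight 2,
and hence zero. -/
lemma levelOne_weight_26_eq_zero {f : ModularForm 𝒮ℒ 26} (h0 : (qExpansion 1 f).coeff 0 = 0)
    (h1 : (qExpansion 1 f).coeff 1 = 0) : f = 0 := by
  have e := qExpansion_eq_qExpansion_discriminant_mul f h0
  set g : ModularForm 𝒮ℒ (26 - 12) := CuspForm.discriminantEquiv (f.toCuspForm h0) with hg
  have d0 : (qExpansion 1 discriminant).coeff 0 = 0 :=
    PowerSeries.coeff_of_lt_order 0 (by simp [discriminant_qExpansion_order])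
  have hg0 : (qExpansion 1 g).coeff 0 = 0 := by
    rw [e, PowerSeries.coeff_mul, Finset.Nat.sum_antidiagonal_eq_sum_range_succ_mk] at h1
    simpa [Finset.sum_range_succ, d0, discriminant_qExpansion_coeff_one] using h1
  have e' := qExpansion_eq_qExpansion_discriminant_mul g hg0
  have hz : (CuspForm.discriminantEquiv (g.toCuspForm hg0) : ModularForm 𝒮ℒ (26 - 12 - 12)) = 0 :=
    rank_zero_iff_forall_zero.mp levelOne_weight_two_rank_zero _
  have hg' : g = 0 := by
    rw [← ModularForm.qExpansion_eq_zero_iff one_pos one_mem_strictPeriods_SL, e', hz,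
      (ModularForm.qExpansion_eq_zero_iff one_pos one_mem_strictPeriods_SL _).mpr rfl, mul_zero]
  rw [← ModularForm.qExpansion_eq_zero_iff one_pos one_mem_strictPeriods_SL, e, hg',
    (ModularForm.qExpansion_eq_zero_iff one_pos one_mem_strictPeriods_SL _).mpr rfl, mul_zero]

end LevelOne

/-! ### Theta series of Leech lattices -/

section Leech

open UpperHalfPlane ModularForm
open scoped MatrixGroups

variable {L : Submodule ℤ (EuclideanSpace ℝ (Fin 24))}

lemma thetaCoeff_zero {n : ℕ} (L : Submodule ℤ (EuclideanSpace ℝ (Fin n)))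
    (p : MvPolynomial (Fin n) ℂ) : thetaCoeff L p 0 = polyEval p 0 := by
  have : shell L (2 * 0) = {0} := by
    ext x
    simp only [shell, Set.mem_ofPred_eq, mul_zero, Nat.cast_zero, inner_self_eq_zero,
      Set.mem_singleton_iff, and_iff_right_iff_imp]
    rintro rfl
    exact L.zero_mem
  rw [thetaCoeff, this, finsum_mem_singleton]

lemma IsLeechLattice.thetaCoeff_one (hL : IsLeechLattice L) (p : MvPolynomial (Fin 24) ℂ) :
    thetaCoeff L p 1 = 0 := by
  rw [thetaCoeff, show 2 * 1 = 2 by rfl, hL.shell_two, finsum_mem_empty]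

lemma polyEval_zero_of_isHomogeneous {n k : ℕ} (hk : 0 < k) {p : MvPolynomial (Fin n) ℂ}
    (hp : p.IsHomogeneous k) : polyEval p 0 = 0 := by
  have := eval_const_mul_of_isHomogeneous hp 0 0
  simpa [polyEval, hk.ne'] using this

lemma isHomogeneous_of_mem_harmonicPoly {n k : ℕ} {p : MvPolynomial (Fin n) ℂ}
    (hp : p ∈ harmonicPoly n k) : p.IsHomogeneous k :=
  (MvPolynomial.mem_homogeneousSubmodule k p).mp hp.1

lemma one_mem_harmonicPoly (n : ℕ) : (1 : MvPolynomial (Fin n) ℂ) ∈ harmonicPoly n 0 :=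
  ⟨MvPolynomial.isHomogeneous_one _ _, by simp [polyLaplacian_apply]⟩

lemma IsLeechLattice.thetaForm_coeff_le_one (hL : IsLeechLattice L) {k : ℕ} (hk : 0 < k)
    {p : MvPolynomial (Fin 24) ℂ} (hp : p ∈ harmonicPoly 24 k) {m : ℕ} (hm : m ≤ 1) :
    (qExpansion 1 (hL.evenUnimodular.thetaForm hp)).coeff m = 0 := by
  rw [hL.evenUnimodular.qExpansion_thetaForm_coeff]
  interval_cases m
  · rw [thetaCoeff_zero, polyEval_zero_of_isHomogeneous hk (isHomogeneous_of_mem_harmonicPoly hp)]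
  · exact hL.thetaCoeff_one p

lemma IsLeechLattice.thetaForm_eq_zero (hL : IsLeechLattice L) {k : ℕ}
    (hk : k ∈ ({2, 4, 6, 8, 10, 14} : Finset ℕ)) {p : MvPolynomial (Fin 24) ℂ}
    (hp : p ∈ harmonicPoly 24 k) : hL.evenUnimodular.thetaForm hp = 0 := by
  have hk0 : 0 < k := by
    rcases Nat.eq_zero_or_pos k with rfl | h
    · simp at hk
    · exact h
  by_cases h14 : k = 14
  · subst h14
    exact levelOne_weight_26_eq_zero (hL.thetaForm_coeff_le_one hk0 hp zero_le_one)
      (hL.thetaForm_coeff_le_one hk0 hp le_rfl)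
  · refine levelOne_ext fun m hm ↦ ?_
    rw [FunLike.coe_zero, (UpperHalfPlane.qExpansion_zero 1), map_zero]
    refine hL.thetaForm_coeff_le_one hk0 hp ?_
    have : k ≤ 10 := by
      simp only [Finset.mem_insert, Finset.mem_singleton] at hk
      omega
    rw [Int.toNat_natCast] at hm
    omega

/-- A theta series with coefficient of positive degree is determined, in weight less than 36, by
its coefficient in degree 2, if there is a form with leading term `q²`. -/
lemma IsLeechLattice.thetaForm_eq_smul (hL : IsLeechLattice L) {k : ℕ} (hk : 0 < k) (hk' : k < 24)
    {p : MvPolynomial (Fin 24) ℂ} (hp : p ∈ harmonicPoly 24 k)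
    {g : ModularForm 𝒮ℒ ((12 + k : ℕ) : ℤ)}
    {a₃ a₄ a₅ : ℂ} (hg : HasCoeffs (qExpansion 1 g) 0 0 1 a₃ a₄ a₅) :
    hL.evenUnimodular.thetaForm hp = thetaCoeff L p 2 • g := by
  refine levelOne_ext fun m hm ↦ ?_
  rw [FunLike.coe_smul, ModularForm.qExpansion_smul one_pos one_mem_strictPeriods_SL,
    PowerSeries.coeff_smul]
  have hm2 : m ≤ 2 := by rw [Int.toNat_natCast] at hm; omega
  interval_cases m
  · rw [hL.thetaForm_coeff_le_one hk hp zero_le_one, hg.coeff_zero, smul_zero]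
  · rw [hL.thetaForm_coeff_le_one hk hp le_rfl, hg.coeff_one, smul_zero]
  · rw [hL.evenUnimodular.qExpansion_thetaForm_coeff, hg.coeff_two, smul_eq_mul, mul_one]

/-- `E₄³ - 720 Δ` as a modular form of weight 12. -/
noncomputable def leechThetaForm : ModularForm 𝒮ℒ 12 :=
  E₄CubeForm - (720 : ℂ) • discriminantForm

lemma leechThetaForm_apply (z : ℍ) : leechThetaForm z = E₄ z ^ 3 - 720 * discriminant z := by
  simp [leechThetaForm, E₄CubeForm_apply, discriminantForm_apply]

lemma hasCoeffs_leechThetaForm :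
    HasCoeffs (qExpansion 1 leechThetaForm) 1 0 196560 16773120 398034000 4629381120 := by
  have h := hasCoeffs_E₄Cube.sub (hasCoeffs_discriminant.smul 720)
  rw [leechThetaForm, FunLike.coe_sub,
    ModularForm.qExpansion_sub one_pos one_mem_strictPeriods_SL,
    FunLike.coe_smul, ModularForm.qExpansion_smul one_pos one_mem_strictPeriods_SL]
  norm_num at h
  exact h

lemma IsLeechLattice.thetaForm_one (hL : IsLeechLattice L) :
    hL.evenUnimodular.thetaForm (one_mem_harmonicPoly 24) = leechThetaForm := by
  refine levelOne_ext fun m hm ↦ ?_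
  have hm1 : m ≤ 1 := hm
  rw [hL.evenUnimodular.qExpansion_thetaForm_coeff]
  interval_cases m
  · rw [hasCoeffs_leechThetaForm.coeff_zero, thetaCoeff_zero]
    simp [polyEval]
  · rw [hasCoeffs_leechThetaForm.coeff_one, hL.thetaCoeff_one]

lemma IsEvenUnimodular.hasThetaSeries (hL : IsEvenUnimodular L) {k : ℕ}
    {p : MvPolynomial (Fin 24) ℂ} (hp : p ∈ harmonicPoly 24 k) :
    HasThetaSeries L p (hL.thetaForm hp) :=
  fun z ↦ hL.hasSum_thetaSeries p z.im_pos

/-- The sum over a shell of a polynomial, as a linear form. -/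
noncomputable def IsEvenUnimodular.thetaCoeffLinear {n : ℕ}
    {L : Submodule ℤ (EuclideanSpace ℝ (Fin n))} (hL : IsEvenUnimodular L) (m : ℕ) :
    MvPolynomial (Fin n) ℂ →ₗ[ℂ] ℂ where
  toFun p := thetaCoeff L p m
  map_add' p q := by
    simp only [thetaCoeff, polyEval, map_add]
    exact finsum_mem_add_distrib (hL.finite_shell _)
  map_smul' c p := by
    simp only [thetaCoeff, polyEval, MvPolynomial.smul_eval, RingHom.id_apply, smul_eq_mul]
    exact (mul_finsum_mem _ c).symm

lemma IsEvenUnimodular.thetaCoeff_one_left {n : ℕ} {L : Submodule ℤ (EuclideanSpace ℝ (Fin n))}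
    (hL : IsEvenUnimodular L) (m : ℕ) : thetaCoeff L 1 m = (shell L (2 * m)).ncard := by
  rw [thetaCoeff, finsum_mem_eq_finite_toFinset_sum _ (hL.finite_shell _),
    Set.ncard_eq_toFinset_card _ (hL.finite_shell _)]
  simp [polyEval]

lemma IsLeechLattice.ncard_shell (hL : IsLeechLattice L) :
    (shell L 4).ncard = 196560 ∧ (shell L 6).ncard = 16773120 ∧
      (shell L 8).ncard = 398034000 ∧ (shell L 10).ncard = 4629381120 := by
  have h (m : ℕ) : ((shell L (2 * m)).ncard : ℂ) = (qExpansion 1 leechThetaForm).coeff m := by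
    rw [← hL.evenUnimodular.thetaCoeff_one_left, ← hL.thetaForm_one,
      hL.evenUnimodular.qExpansion_thetaForm_coeff]
  obtain ⟨-, -, h2, h3, h4, h5⟩ := hasCoeffs_leechThetaForm
  refine ⟨?_, ?_, ?_, ?_⟩
  · exact_mod_cast (h 2).trans h2
  · exact_mod_cast (h 3).trans h3
  · exact_mod_cast (h 4).trans h4
  · exact_mod_cast (h 5).trans h5

lemma IsLeechLattice.thetaCoeff_eq_zero (hL : IsLeechLattice L) {k : ℕ}
    (hk : k ∈ ({2, 4, 6, 8, 10, 14} : Finset ℕ)) {p : MvPolynomial (Fin 24) ℂ}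
    (hp : p ∈ harmonicPoly 24 k) (m : ℕ) : thetaCoeff L p m = 0 := by
  rw [← hL.evenUnimodular.qExpansion_thetaForm_coeff hp, hL.thetaForm_eq_zero hk,
    FunLike.coe_zero, UpperHalfPlane.qExpansion_zero, map_zero]

lemma IsLeechLattice.thetaCoeff_eq_mul (hL : IsLeechLattice L) {k : ℕ} (hk : 0 < k) (hk' : k < 24)
    {p : MvPolynomial (Fin 24) ℂ} (hp : p ∈ harmonicPoly 24 k)
    {g : ModularForm 𝒮ℒ ((12 + k : ℕ) : ℤ)}
    {a₃ a₄ a₅ : ℂ} (hg : HasCoeffs (qExpansion 1 g) 0 0 1 a₃ a₄ a₅) :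
    thetaCoeff L p 3 = thetaCoeff L p 2 * a₃ ∧ thetaCoeff L p 4 = thetaCoeff L p 2 * a₄ ∧
      thetaCoeff L p 5 = thetaCoeff L p 2 * a₅ := by
  have h (m : ℕ) : thetaCoeff L p m = thetaCoeff L p 2 * (qExpansion 1 g).coeff m := by
    rw [← hL.evenUnimodular.qExpansion_thetaForm_coeff hp m, hL.thetaForm_eq_smul hk hk' hp hg,
      FunLike.coe_smul, ModularForm.qExpansion_smul one_pos one_mem_strictPeriods_SL,
      PowerSeries.coeff_smul, smul_eq_mul]
  exact ⟨hg.coeff_three ▸ h 3, hg.coeff_four ▸ h 4, hg.coeff_five ▸ h 5⟩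

theorem IsLeechLattice.thetaSeries_one (hL : IsLeechLattice L) :
    HasThetaSeries L 1 fun z ↦ E₄ z ^ 3 - 720 * discriminant z := by
  have h := hL.evenUnimodular.hasThetaSeries (one_mem_harmonicPoly 24)
  rw [hL.thetaForm_one] at h
  intro z
  change HasSum _ (E₄ z ^ 3 - 720 * discriminant z)
  rw [← leechThetaForm_apply]
  exact h z

theorem IsLeechLattice.thetaSeries_eq_zero (hL : IsLeechLattice L) {k : ℕ}
    (hk : k ∈ ({2, 4, 6, 8, 10, 14} : Finset ℕ)) {p : MvPolynomial (Fin 24) ℂ}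
    (hp : p ∈ harmonicPoly 24 k) : HasThetaSeries L p fun _ ↦ 0 := by
  have h := hL.evenUnimodular.hasThetaSeries hp
  rwa [hL.thetaForm_eq_zero hk] at h

theorem IsLeechLattice.exists_thetaSeries_eq (hL : IsLeechLattice L) {k : ℕ} (hk : 0 < k)
    (hk' : k < 24)
    {g : ModularForm 𝒮ℒ ((12 + k : ℕ) : ℤ)}
    {a₃ a₄ a₅ : ℂ} (hg : HasCoeffs (qExpansion 1 g) 0 0 1 a₃ a₄ a₅) :
    ∃ c : harmonicPoly 24 k →ₗ[ℂ] ℂ, ∀ p : harmonicPoly 24 k,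
      HasThetaSeries L p fun z ↦ c p * g z := by
  refine ⟨hL.evenUnimodular.thetaCoeffLinear 2 ∘ₗ (harmonicPoly 24 k).subtype, fun p ↦ ?_⟩
  have h := hL.evenUnimodular.hasThetaSeries p.2
  rw [hL.thetaForm_eq_smul hk hk' p.2 hg] at h
  exact h

lemma discriminantSqForm_apply (z : ℍ) : discriminantSqForm z = discriminant z ^ 2 := by
  rw [pow_two, ← discriminantForm_apply]; rfl

lemma E₄DiscriminantSqForm_apply (z : ℍ) :
    E₄DiscriminantSqForm z = E₄ z * discriminant z ^ 2 := by
  rw [← discriminantSqForm_apply]; rfl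

lemma E₆DiscriminantSqForm_apply (z : ℍ) :
    E₆DiscriminantSqForm z = E₆ z * discriminant z ^ 2 := by
  rw [← discriminantSqForm_apply]; rfl

end Leech

/-! ### Harmonic polynomials -/

section Harmonic

open MvPolynomial

variable {n : ℕ}

/-- The polynomial `‖x‖² = ∑ i, x i ^ 2`. -/
noncomputable def normSqPoly (n : ℕ) : MvPolynomial (Fin n) ℂ := ∑ i, X i ^ 2

lemma isHomogeneous_normSqPoly (n : ℕ) : (normSqPoly n).IsHomogeneous 2 :=
  IsHomogeneous.sum _ _ _ fun i _ ↦ by simpa using (isHomogeneous_X ℂ i).pow 2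

lemma polyEval_normSqPoly (x : EuclideanSpace ℝ (Fin n)) :
    polyEval (normSqPoly n) x = ‖x‖ ^ 2 := by
  rw [← Complex.ofReal_pow, EuclideanSpace.real_norm_sq_eq]
  simp [polyEval, normSqPoly]

lemma isHomogeneous_polyLaplacian {k : ℕ} {p : MvPolynomial (Fin n) ℂ}
    (hp : p.IsHomogeneous (k + 2)) : (polyLaplacian n p).IsHomogeneous k := by
  rw [polyLaplacian_apply]
  exact IsHomogeneous.sum _ _ _ fun i _ ↦ hp.pderiv.pderiv

lemma polyLaplacian_eq_zero_of_lt_two {k : ℕ} (hk : k < 2) {p : MvPolynomial (Fin n) ℂ}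
    (hp : p.IsHomogeneous k) : polyLaplacian n p = 0 := by
  rw [polyLaplacian_apply]
  refine Finset.sum_eq_zero fun i _ ↦ ?_
  have h : (pderiv i p).IsHomogeneous 0 := by
    simpa [show k - 1 = 0 by omega] using hp.pderiv (i := i)
  rw [← totalDegree_zero_iff_isHomogeneous, totalDegree_eq_zero_iff_eq_C] at h
  rw [h, pderiv_C]

lemma polyLaplacian_normSqPoly_mul {k : ℕ} {p : MvPolynomial (Fin n) ℂ}
    (hp : p.IsHomogeneous k) : polyLaplacian n (normSqPoly n * p) =
      normSqPoly n * polyLaplacian n p + (2 * n + 4 * k : ℂ) • p := by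
  have h (i : Fin n) : polyLaplacian n (X i ^ 2 * p) =
      X i ^ 2 * polyLaplacian n p + 4 * (X i * pderiv i p) + 2 * p := by
    rw [show X i ^ 2 * p = p * X i * X i by ring, polyLaplacian_mul_X, polyLaplacian_mul_X,
      pderiv_mul, pderiv_X_self]
    simp only [nsmul_eq_mul]
    push_cast
    ring
  rw [normSqPoly, Finset.sum_mul, map_sum, Finset.sum_congr rfl fun i _ ↦ h i,
    Finset.sum_add_distrib, Finset.sum_add_distrib, ← Finset.sum_mul, ← Finset.mul_sum,
    hp.sum_X_mul_pderiv, Finset.sum_const, Finset.card_univ, Fintype.card_fin,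
    smul_eq_C_mul]
  simp only [nsmul_eq_mul, map_add, map_mul, map_natCast, map_ofNat]
  ring

/-- The operator `r² Δ + c` on homogeneous polynomials is surjective for `c > 0`: in a solution `q`
of `r² Δ q + c q = f` the polynomial `u = Δ q` solves an equation of the same form in
degree two less. -/
lemma exists_normSqPoly_mul_polyLaplacian_add_eq (k : ℕ) : ∀ (c : ℝ), 0 < c →
    ∀ f : MvPolynomial (Fin n) ℂ, f.IsHomogeneous k → ∃ q : MvPolynomial (Fin n) ℂ,
      q.IsHomogeneous k ∧ normSqPoly n * polyLaplacian n q + (c : ℂ) • q = f := by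
  induction k using Nat.twoStepInduction with
  | zero =>
    intro c hc f hf
    have hc' : (c : ℂ) ≠ 0 := by exact_mod_cast hc.ne'
    refine ⟨(c : ℂ)⁻¹ • f, (homogeneousSubmodule _ _ _).smul_mem _ hf, ?_⟩
    rw [map_smul, polyLaplacian_eq_zero_of_lt_two (by norm_num) hf, smul_zero, mul_zero, zero_add,
      smul_inv_smul₀ hc']
  | one =>
    intro c hc f hf
    have hc' : (c : ℂ) ≠ 0 := by exact_mod_cast hc.ne'
    refine ⟨(c : ℂ)⁻¹ • f, (homogeneousSubmodule _ _ _).smul_mem _ hf, ?_⟩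
    rw [map_smul, polyLaplacian_eq_zero_of_lt_two (by norm_num) hf, smul_zero, mul_zero, zero_add,
      smul_inv_smul₀ hc']
  | more k ih _ =>
    intro c hc f hf
    have hc' : (c : ℂ) ≠ 0 := by exact_mod_cast hc.ne'
    obtain ⟨u, hu, hu'⟩ := ih (2 * n + 4 * k + c) (by positivity) _
      (isHomogeneous_polyLaplacian hf)
    have hru : (normSqPoly n * u).IsHomogeneous (k + 2) := by
      rw [add_comm]
      exact (isHomogeneous_normSqPoly n).mul hu
    have hΔ : polyLaplacian n ((c : ℂ)⁻¹ • (f - normSqPoly n * u)) = u := by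
      rw [map_smul, map_sub, polyLaplacian_normSqPoly_mul hu, ← hu', inv_smul_eq_iff₀ hc']
      push_cast
      module
    refine ⟨(c : ℂ)⁻¹ • (f - normSqPoly n * u),
      (homogeneousSubmodule _ _ _).smul_mem _ (hf.sub hru), ?_⟩
    rw [hΔ, smul_inv_smul₀ hc', add_sub_cancel]

/-- A homogeneous polynomial is the sum of a harmonic one and a multiple of `r²`. -/
lemma exists_eq_harmonic_add_normSqPoly_mul (hn : 0 < n) {k : ℕ} {p : MvPolynomial (Fin n) ℂ}
    (hp : p.IsHomogeneous (k + 2)) : ∃ h ∈ harmonicPoly n (k + 2), ∃ q : MvPolynomial (Fin n) ℂ,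
      q.IsHomogeneous k ∧ p = h + normSqPoly n * q := by
  obtain ⟨q, hq, hq'⟩ := exists_normSqPoly_mul_polyLaplacian_add_eq k (2 * n + 4 * k)
    (by positivity) _ (isHomogeneous_polyLaplacian hp)
  have hrq : (normSqPoly n * q).IsHomogeneous (k + 2) := by
    rw [add_comm]
    exact (isHomogeneous_normSqPoly n).mul hq
  refine ⟨p - normSqPoly n * q, ⟨hp.sub hrq, ?_⟩, q, hq, (sub_add_cancel _ _).symm⟩
  rw [SetLike.mem_coe, LinearMap.mem_ker, map_sub, polyLaplacian_normSqPoly_mul hq, ← hq']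
  push_cast
  exact sub_self _

/-- A linear form on polynomials that does not distinguish `r²` from `1` is determined by its values
on the harmonic polynomials. -/
lemma linearForm_eq_zero_of_harmonic (hn : 0 < n) {t : ℕ} (F : MvPolynomial (Fin n) ℂ →ₗ[ℂ] ℂ)
    (hF : ∀ p, F (normSqPoly n * p) = F p)
    (h : ∀ k ≤ t, ∀ p ∈ harmonicPoly n k, F p = 0) (p : MvPolynomial (Fin n) ℂ)
    (hp : p.totalDegree ≤ t) : F p = 0 := by
  have hom (k : ℕ) (hk : k ≤ t) (q : MvPolynomial (Fin n) ℂ) (hq : q.IsHomogeneous k) :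
      F q = 0 := by
    induction k using Nat.twoStepInduction generalizing q with
    | zero => exact h 0 hk q ⟨hq, polyLaplacian_eq_zero_of_lt_two (by norm_num) hq⟩
    | one => exact h 1 hk q ⟨hq, polyLaplacian_eq_zero_of_lt_two (by norm_num) hq⟩
    | more k ih _ =>
      obtain ⟨u, hu, v, hv, rfl⟩ := exists_eq_harmonic_add_normSqPoly_mul hn hq
      rw [map_add, h _ hk u hu, hF, ih (by omega) v hv, add_zero]
  rw [← sum_homogeneousComponent p, map_sum]
  exact Finset.sum_eq_zero fun k hk ↦ hom k (by rw [Finset.mem_range] at hk; omega) _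
    (homogeneousComponent_isHomogeneous k p)

end Harmonic

/-! ### Integration over the sphere -/

section Sphere

open Module FourierTransform

variable {n : ℕ}

lemma isProbabilityMeasure_sphereMeasure (hn : 0 < n) :
    IsProbabilityMeasure (sphereMeasure n) := by
  have : Nonempty (Fin n) := ⟨⟨0, hn⟩⟩
  have h : NeZero (volume : Measure (EuclideanSpace ℝ (Fin n))).toSphere :=
    ⟨Measure.toSphere_ne_zero _⟩
  refine ⟨?_⟩
  rw [sphereMeasure, Measure.smul_apply, smul_eq_mul]
  exact ENNReal.inv_mul_cancel (Measure.measure_univ_ne_zero.mpr h.out) (measure_ne_top _ _)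

lemma polyEval_real_smul {k : ℕ} {p : MvPolynomial (Fin n) ℂ} (hp : p.IsHomogeneous k) (c : ℝ)
    (x : EuclideanSpace ℝ (Fin n)) : polyEval p (c • x) = c ^ k * polyEval p x := by
  have := eval_const_mul_of_isHomogeneous hp (c : ℂ) (fun i ↦ (x i : ℂ))
  simpa [polyEval] using this

/-- The integral of a homogeneous polynomial times a Gaussian, in polar coordinates. -/
lemma integral_polyEval_mul_gaussian {k : ℕ} (hn : 0 < n) {p : MvPolynomial (Fin n) ℂ}
    (hp : p.IsHomogeneous k) :
    ∫ x : EuclideanSpace ℝ (Fin n), polyEval p x * Complex.exp (-Real.pi * ‖x‖ ^ 2) =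
      (∫ u, polyEval p u ∂(volume : Measure (EuclideanSpace ℝ (Fin n))).toSphere) *
        ((∫ r in Set.Ioi (0 : ℝ), r ^ ((n - 1 + k : ℕ) : ℝ) * Real.exp (-Real.pi * r ^ (2 : ℝ)) : ℝ)
          : ℂ) := by
  have : Nonempty (Fin n) := ⟨⟨0, hn⟩⟩
  set μ : Measure (EuclideanSpace ℝ (Fin n)) := volume
  let φ : Set.Ioi (0 : ℝ) → ℂ := fun r ↦ ((r : ℝ) ^ k * Real.exp (-Real.pi * (r : ℝ) ^ 2) : ℝ)
  have h1 : ∫ x : EuclideanSpace ℝ (Fin n), polyEval p x * Complex.exp (-Real.pi * ‖x‖ ^ 2) ∂μ =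
      ∫ y, polyEval p y.1 * φ y.2 ∂μ.toSphere.prod
        (.volumeIoiPow (finrank ℝ (EuclideanSpace ℝ (Fin n)) - 1)) := by
    rw [← μ.measurePreserving_homeomorphUnitSphereProd.integral_comp
      (Homeomorph.measurableEmbedding _)]
    conv_lhs => rw [← restrict_compl_singleton (μ := μ) 0,
      ← integral_subtype_comap (measurableSet_singleton _).compl]
    refine integral_congr_ae (.of_forall fun x ↦ ?_)
    have hx : (‖(x : EuclideanSpace ℝ (Fin n))‖ : ℂ) ≠ 0 := by
      exact_mod_cast norm_ne_zero_iff.mpr x.2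
    simp only [φ, homeomorphUnitSphereProd_apply_fst_coe, homeomorphUnitSphereProd_apply_snd_coe,
      polyEval_real_smul hp]
    push_cast
    field_simp
    rw [mul_assoc, ← mul_pow, one_div_mul_cancel hx, one_pow, mul_one]
  have h2 : ∫ r, φ r ∂(.volumeIoiPow (n - 1)) = ((∫ r in Set.Ioi (0 : ℝ),
      r ^ ((n - 1 + k : ℕ) : ℝ) * Real.exp (-Real.pi * r ^ (2 : ℝ)) : ℝ) : ℂ) := by
    simp only [φ, Measure.volumeIoiPow, ENNReal.ofReal]
    rw [integral_complex_ofReal, integral_withDensity_eq_integral_smul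
      (measurable_subtype_coe.pow_const _).real_toNNReal,
      integral_subtype_comap measurableSet_Ioi fun a : ℝ ↦
        Real.toNNReal (a ^ (n - 1)) • (a ^ k * Real.exp (-Real.pi * a ^ 2)),
      setIntegral_congr_fun measurableSet_Ioi fun x hx ↦ ?_]
    simp only [NNReal.smul_def, Real.coe_toNNReal _ (pow_nonneg (Set.mem_Ioi.mp hx).le _),
      Real.rpow_natCast, Real.rpow_two, pow_add, smul_eq_mul, mul_assoc]
  rw [h1, integral_prod_mul (fun u : Metric.sphere (0 : EuclideanSpace ℝ (Fin n)) 1 ↦ polyEval p u)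
    φ, finrank_euclideanSpace_fin, h2]

/-- Harmonic polynomials of positive degree have mean value zero: the integral against the Gaussian
`exp (-π ‖x‖²)` is a Fourier transform at `0`, which vanishes, and its radial factor is a value of
the Gamma function. -/
theorem integral_sphere_harmonic (hn : 0 < n) {k : ℕ} (hk : 0 < k) {p : MvPolynomial (Fin n) ℂ}
    (hp : p ∈ harmonicPoly n k) : ∫ u, polyEval p u ∂(sphereMeasure n) = 0 := by
  have hpi : 0 < (Real.pi : ℂ).re := by simpa using Real.pi_pos
  have h := fourier_harmonicPoly_mul_gaussian hpi hp 0
  rw [polyEval_zero_of_isHomogeneous hk (isHomogeneous_of_mem_harmonicPoly hp), mul_zero, mul_zero,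
    zero_mul, Real.fourier_eq'] at h
  simp only [inner_zero_right, mul_zero, Complex.ofReal_zero, zero_mul, Complex.exp_zero,
    one_smul] at h
  rw [integral_polyEval_mul_gaussian hn (isHomogeneous_of_mem_harmonicPoly hp), mul_eq_zero] at h
  rw [sphereMeasure, integral_smul_measure, h.resolve_right, smul_zero]
  rw [Complex.ofReal_eq_zero, integral_rpow_mul_exp_neg_mul_rpow two_pos
    (lt_of_lt_of_le neg_one_lt_zero (Nat.cast_nonneg _)) Real.pi_pos]
  have : 0 < Real.Gamma ((((n - 1 + k : ℕ) : ℝ) + 1) / 2) := Real.Gamma_pos_of_pos (by positivity)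
  positivity

end Sphere

/-! ### Testing cubature formulas on harmonic polynomials -/

section Cubature

open MvPolynomial

variable {n : ℕ}

lemma integrable_polyEval_sphere (hn : 0 < n) (p : MvPolynomial (Fin n) ℂ) :
    Integrable (fun u : Metric.sphere (0 : EuclideanSpace ℝ (Fin n)) 1 ↦ polyEval p u)
      (sphereMeasure n) := by
  have := isProbabilityMeasure_sphereMeasure hn
  exact ((continuous_polyEval p).comp continuous_subtype_val).integrable_of_hasCompactSupport
    (HasCompactSupport.of_compactSpace _)

/-- The harmonic polynomials of positive degree, which have mean value zero, and the constants
suffice to test a cubature formula. -/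
theorem isCubatureFormula_of_harmonic (hn : 0 < n) {t : ℕ} {X : Set (EuclideanSpace ℝ (Fin n))}
    {W : EuclideanSpace ℝ (Fin n) → ℝ} (hX : X.Finite) (hXs : X ⊆ Metric.sphere 0 1)
    (hW : ∀ x ∈ X, 0 < W x) (h0 : ∑ x ∈ hX.toFinset, (W x : ℂ) = 1)
    (h : ∀ k, 0 < k → k ≤ t → ∀ p ∈ harmonicPoly n k,
      ∑ x ∈ hX.toFinset, (W x : ℂ) * polyEval p x = 0) : IsCubatureFormula t X W := by
  refine ⟨hX, hXs, hW, fun p hp ↦ ?_⟩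
  have := isProbabilityMeasure_sphereMeasure hn
  let F : MvPolynomial (Fin n) ℂ →ₗ[ℂ] ℂ :=
    { toFun p := ∑ x ∈ hX.toFinset, (W x : ℂ) * polyEval p x - ∫ u, polyEval p u ∂(sphereMeasure n)
      map_add' p q := by
        have : ∀ x, polyEval (p + q) x = polyEval p x + polyEval q x := fun x ↦ map_add _ _ _
        simp only [this, mul_add, Finset.sum_add_distrib]
        rw [integral_add (integrable_polyEval_sphere hn p) (integrable_polyEval_sphere hn q)]
        ring
      map_smul' c p := by
        have : ∀ x, polyEval (c • p) x = c * polyEval p x := fun x ↦ smul_eval _ _ _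
        simp only [this, RingHom.id_apply, smul_eq_mul, mul_sub, Finset.mul_sum,
          integral_const_mul, mul_left_comm c] }
  have hF (p) : F p = ∑ x ∈ hX.toFinset, (W x : ℂ) * polyEval p x -
      ∫ u, polyEval p u ∂(sphereMeasure n) := rfl
  have hmul (p x) (hx : x ∈ Metric.sphere (0 : EuclideanSpace ℝ (Fin n)) 1) :
      polyEval (normSqPoly n * p) x = polyEval p x := by
    have h1 : polyEval (normSqPoly n * p) x = polyEval (normSqPoly n) x * polyEval p x :=
      map_mul _ _ _
    rw [h1, polyEval_normSqPoly, mem_sphere_zero_iff_norm.mp hx]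
    simp
  refine sub_eq_zero.mp (linearForm_eq_zero_of_harmonic hn F (fun p ↦ ?_) (fun k hk p hp ↦ ?_) p hp)
  · refine congr_arg₂ (fun a b : ℂ ↦ a - b) (Finset.sum_congr rfl fun x hx ↦ ?_)
      (integral_congr_ae (.of_forall ?_))
    · rw [hmul p x (hXs (hX.mem_toFinset.mp hx))]
    · exact fun u ↦ hmul p u u.2
  · rcases Nat.eq_zero_or_pos k with rfl | hk0
    · have hc := (totalDegree_eq_zero_iff_eq_C).mp
        ((totalDegree_zero_iff_isHomogeneous _).mpr (isHomogeneous_of_mem_harmonicPoly hp))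
      have hc' (x : EuclideanSpace ℝ (Fin n)) : polyEval p x = coeff 0 p := by
        rw [polyEval, hc, eval_C, coeff_C, if_pos rfl]
      rw [hF]
      simp [hc', ← Finset.sum_mul, h0]
    · rw [hF, h k hk0 hk p hp, integral_sphere_harmonic hn hk0 hp, sub_zero]

lemma IsCubatureFormula.congr {t : ℕ} {X : Set (EuclideanSpace ℝ (Fin n))}
    {W W' : EuclideanSpace ℝ (Fin n) → ℝ} (h : IsCubatureFormula t X W) (hW : Set.EqOn W W' X) :
    IsCubatureFormula t X W' := by
  refine ⟨h.finite, h.subset_sphere, fun x hx ↦ hW hx ▸ h.weight_pos x hx, fun p hp ↦ ?_⟩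
  rw [← h.sum_eq_integral p hp]
  exact Finset.sum_congr rfl fun x hx ↦ by rw [hW (h.finite.mem_toFinset.mp hx)]

end Cubature

/-! ### Shells of lattices -/

section Shells

variable {n : ℕ} {L : Submodule ℤ (EuclideanSpace ℝ (Fin n))}

lemma inv_sqrt_smul_injective {m : ℕ} (hm : 0 < m) :
    Function.Injective fun x : EuclideanSpace ℝ (Fin n) ↦ (√(m : ℝ))⁻¹ • x :=
  smul_right_injective _ (inv_ne_zero (Real.sqrt_ne_zero'.mpr (Nat.cast_pos.mpr hm)))

lemma rescaledShell_subset_sphere {m : ℕ} (hm : 0 < m) :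
    rescaledShell L m ⊆ Metric.sphere 0 1 := by
  rintro _ ⟨x, hx, rfl⟩
  have hm' : √(m : ℝ) ≠ 0 := Real.sqrt_ne_zero'.mpr (Nat.cast_pos.mpr hm)
  have h : ‖x‖ = √(m : ℝ) := by
    rw [← hx.2, real_inner_self_eq_norm_sq, Real.sqrt_sq (norm_nonneg x)]
  rw [mem_sphere_zero_iff_norm, norm_smul, norm_inv, Real.norm_of_nonneg (Real.sqrt_nonneg _), h,
    inv_mul_cancel₀ hm']

lemma ncard_rescaledShell {m : ℕ} (hm : 0 < m) :
    (rescaledShell L m).ncard = (shell L m).ncard :=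
  Set.ncard_image_of_injective _ (inv_sqrt_smul_injective hm)

lemma finsum_rescaledShell {m k : ℕ} (hm : 0 < m) {p : MvPolynomial (Fin n) ℂ}
    (hp : p.IsHomogeneous k) : ∑ᶠ x ∈ rescaledShell L m, polyEval p x =
      ((√(m : ℝ))⁻¹ : ℝ) ^ k * ∑ᶠ x ∈ shell L m, polyEval p x := by
  rw [rescaledShell, finsum_mem_image (inv_sqrt_smul_injective hm).injOn]
  simp only [polyEval_real_smul hp]
  exact (mul_finsum_mem _ _).symm

lemma finsum_shell_of_odd {m k : ℕ} (hk : Odd k) {p : MvPolynomial (Fin n) ℂ}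
    (hp : p.IsHomogeneous k) : ∑ᶠ x ∈ shell L m, polyEval p x = 0 := by
  have hneg : (fun x ↦ -x) '' shell L m = shell L m := by
    ext x
    simp [shell]
  have h : ∑ᶠ x ∈ shell L m, polyEval p x = -∑ᶠ x ∈ shell L m, polyEval p x := by
    conv_lhs => rw [← hneg, finsum_mem_image neg_injective.injOn]
    rw [neg_eq_neg_one_mul, mul_finsum_mem]
    refine finsum_mem_congr rfl fun x _ ↦ ?_
    simpa [hk.neg_one_pow] using polyEval_real_smul hp (-1) x
  exact self_eq_neg.mp h

/-- The inner product of lattice vectors of norms `a` and `b` on the same ray is `√(a b)`, and an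
integer. -/
lemma IsEvenUnimodular.disjoint_rescaledShell (hL : IsEvenUnimodular L) {a b : ℕ} (ha : 0 < a)
    (hb : 0 < b) (h : ¬ IsSquare (a * b)) :
    Disjoint (rescaledShell L a) (rescaledShell L b) := by
  rw [Set.disjoint_left]
  rintro _ ⟨u, hu, rfl⟩ ⟨v, hv, huv⟩
  have huv' : (√(b : ℝ))⁻¹ • v = (√(a : ℝ))⁻¹ • u := huv
  obtain ⟨k, hk⟩ := (hL.mem_iff v).mp hv.1 u hu.1
  have ha' : (0 : ℝ) < a := Nat.cast_pos.mpr ha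
  have hb' : (0 : ℝ) < b := Nat.cast_pos.mpr hb
  have h1 : (√(b : ℝ))⁻¹ * inner ℝ v v = (√(a : ℝ))⁻¹ * inner ℝ u v := by
    rw [← real_inner_smul_left, ← real_inner_smul_left, huv']
  rw [hv.2, hk] at h1
  have h2 : ((k * k : ℤ) : ℝ) = ((a * b : ℕ) : ℝ) := by
    have hsa := Real.sq_sqrt ha'.le
    have hsb := Real.sq_sqrt hb'.le
    have hk' : (k : ℝ) = √(a : ℝ) * ((√(b : ℝ))⁻¹ * b) := by
      rw [h1, mul_inv_cancel_left₀ (Real.sqrt_ne_zero'.mpr ha')]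
    push_cast
    rw [hk']
    have hb0 : √(b : ℝ) ≠ 0 := Real.sqrt_ne_zero'.mpr hb'
    field_simp
    rw [hsa, hsb, mul_comm]
  refine h ⟨k.natAbs, ?_⟩
  rw [← Int.natAbs_mul]
  have h3 : k * k = ((a * b : ℕ) : ℤ) := by exact_mod_cast h2
  rw [h3, Int.natAbs_natCast]

lemma IsEvenUnimodular.finite_shellUnion (hL : IsEvenUnimodular L) (M : Finset ℕ) :
    (shellUnion L M).Finite :=
  M.finite_toSet.biUnion fun m _ ↦ (hL.finite_shell m).image _

lemma IsEvenUnimodular.ncard_shellUnion (hL : IsEvenUnimodular L) {M : Finset ℕ}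
    (hM : ∀ m ∈ M, 0 < m) (h : (M : Set ℕ).PairwiseDisjoint (rescaledShell L)) :
    (shellUnion L M).ncard = ∑ m ∈ M, (shell L m).ncard := by
  have h1 := M.finite_toSet.ncard_biUnion (s := rescaledShell L)
    (fun m _ ↦ (hL.finite_shell m).image _) h
  rw [finsum_mem_coe_finset] at h1
  exact h1.trans (Finset.sum_congr rfl fun m hm ↦ ncard_rescaledShell (hM m hm))

lemma IsEvenUnimodular.sum_shellUnion (hL : IsEvenUnimodular L) (M : Finset ℕ) (w : ℕ → ℝ)
    (f : EuclideanSpace ℝ (Fin n) → ℂ) :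
    ∑ x ∈ (hL.finite_shellUnion M).toFinset, (shellWeight L M w x : ℂ) * f x =
      ∑ m ∈ M, w m * ∑ᶠ x ∈ rescaledShell L m, f x := by
  simp only [shellWeight, Complex.ofReal_sum, Finset.sum_mul]
  rw [Finset.sum_comm]
  refine Finset.sum_congr rfl fun m hm ↦ ?_
  have hsub : rescaledShell L m ⊆ shellUnion L M :=
    Set.subset_biUnion_of_mem (u := rescaledShell L) hm
  have hfin : (rescaledShell L m).Finite := (hL.finite_shell m).image _
  rw [finsum_mem_eq_finite_toFinset_sum _ hfin, Finset.mul_sum]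
  symm
  refine Finset.sum_subset_zero_on_sdiff (Set.Finite.toFinset_subset_toFinset.mpr hsub)
    (fun x hx ↦ ?_) (fun x hx ↦ ?_)
  · simp only [Finset.mem_sdiff, Set.Finite.mem_toFinset] at hx
    rw [Set.indicator_of_notMem hx.2, Complex.ofReal_zero, zero_mul]
  · rw [Set.indicator_of_mem (hfin.mem_toFinset.mp hx)]

/-- Weighted shells form a cubature formula of strength `t` if the sums of the harmonic polynomials
of even positive degree at most `t` over the shells cancel. -/
theorem IsEvenUnimodular.isCubatureFormula_shellUnion (hL : IsEvenUnimodular L) (hn : 0 < n)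
    {t : ℕ} {M : Finset ℕ} {w : ℕ → ℝ} (hM : ∀ m ∈ M, 0 < m) (hw : ∀ m ∈ M, 0 < w m)
    (h0 : ∑ m ∈ M, w m * (shell L m).ncard = 1)
    (h : ∀ j, 0 < j → 2 * j ≤ t → ∀ p ∈ harmonicPoly n (2 * j),
      ∑ m ∈ M, (w m : ℂ) * ((m : ℂ)⁻¹ ^ j * ∑ᶠ x ∈ shell L m, polyEval p x) = 0) :
    IsCubatureFormula t (shellUnion L M) (shellWeight L M w) := by
  refine isCubatureFormula_of_harmonic hn (hL.finite_shellUnion M)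
    (Set.iUnion₂_subset fun m hm ↦ rescaledShell_subset_sphere (hM m hm)) (fun x hx ↦ ?_) ?_
    (fun k hk hkt p hp ↦ ?_)
  · obtain ⟨m, hm, hx⟩ := Set.mem_iUnion₂.mp hx
    refine Finset.sum_pos' (fun m hm ↦ Set.indicator_nonneg (fun _ _ ↦ (hw m hm).le) x) ⟨m, hm, ?_⟩
    rw [Set.indicator_of_mem hx]
    exact hw m hm
  · have := hL.sum_shellUnion M w fun _ ↦ 1
    simp only [mul_one] at this
    rw [this]
    have h0' : ∑ m ∈ M, (w m : ℂ) * (shell L m).ncard = 1 := by exact_mod_cast h0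
    refine Eq.trans (Finset.sum_congr rfl fun m hm ↦ ?_) h0'
    rw [← ncard_rescaledShell (hM m hm)]
    have hfin : (rescaledShell L m).Finite := (hL.finite_shell m).image _
    rw [finsum_mem_eq_finite_toFinset_sum _ hfin, Set.ncard_eq_toFinset_card _ hfin]
    simp
  · have hp' := isHomogeneous_of_mem_harmonicPoly hp
    rw [hL.sum_shellUnion]
    rcases Nat.even_or_odd' k with ⟨j, rfl | rfl⟩
    · rw [← h j (by omega) hkt p hp]
      refine Finset.sum_congr rfl fun m hm ↦ ?_
      rw [finsum_rescaledShell (hM m hm) hp', pow_mul, ← Complex.ofReal_pow, inv_pow,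
        Real.sq_sqrt (Nat.cast_nonneg m)]
      push_cast
      rfl
    · -- the shells are symmetric about the origin
      refine Finset.sum_eq_zero fun m hm ↦ ?_
      rw [finsum_rescaledShell (hM m hm) hp', finsum_shell_of_odd ⟨j, rfl⟩ hp', mul_zero, mul_zero]

end Shells

/-! ### Cubature formulas from Leech lattices -/

section LeechCubature

open UpperHalfPlane ModularForm

variable {L : Submodule ℤ (EuclideanSpace ℝ (Fin 24))}

lemma IsLeechLattice.pairwiseDisjoint_rescaledShell (hL : IsLeechLattice L) :
    ({4, 6, 8, 10} : Set ℕ).PairwiseDisjoint (rescaledShell L) := by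
  have h {a b : ℕ} (ha : 0 < a) (hb : 0 < b) (hab : ¬ IsSquare (a * b)) :=
    hL.evenUnimodular.disjoint_rescaledShell ha hb hab
  intro a ha b hb hab
  simp only [Set.mem_insert_iff, Set.mem_singleton_iff] at ha hb
  rcases ha with rfl | rfl | rfl | rfl <;> rcases hb with rfl | rfl | rfl | rfl <;>
    first | exact absurd rfl hab | exact h (by norm_num) (by norm_num) (by decide +kernel)

lemma IsLeechLattice.thetaCoeff_twelve (hL : IsLeechLattice L) {p : MvPolynomial (Fin 24) ℂ}
    (hp : p ∈ harmonicPoly 24 12) : thetaCoeff L p 3 = thetaCoeff L p 2 * (-48) ∧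
      thetaCoeff L p 4 = thetaCoeff L p 2 * 1080 ∧
      thetaCoeff L p 5 = thetaCoeff L p 2 * (-15040) :=
  hL.thetaCoeff_eq_mul (by norm_num) (by norm_num) hp hasCoeffs_discriminantSq

lemma IsLeechLattice.thetaCoeff_sixteen (hL : IsLeechLattice L) {p : MvPolynomial (Fin 24) ℂ}
    (hp : p ∈ harmonicPoly 24 16) : thetaCoeff L p 3 = thetaCoeff L p 2 * 192 ∧
      thetaCoeff L p 4 = thetaCoeff L p 2 * (-8280) ∧
      thetaCoeff L p 5 = thetaCoeff L p 2 * 147200 :=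
  hL.thetaCoeff_eq_mul (by norm_num) (by norm_num) hp hasCoeffs_E₄DiscriminantSq

lemma IsLeechLattice.thetaCoeff_eighteen (hL : IsLeechLattice L) {p : MvPolynomial (Fin 24) ℂ}
    (hp : p ∈ harmonicPoly 24 18) : thetaCoeff L p 3 = thetaCoeff L p 2 * (-552) ∧
      thetaCoeff L p 4 = thetaCoeff L p 2 * 8640 ∧
      thetaCoeff L p 5 = thetaCoeff L p 2 * 116000 :=
  hL.thetaCoeff_eq_mul (by norm_num) (by norm_num) hp hasCoeffs_E₆DiscriminantSq

/-- In strength at most `19`, only the degrees `2 j = 12`, `16` and `18` and the total mass impose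
conditions on the weights of the shells: in the other even degrees the theta series vanish. -/
theorem IsLeechLattice.isCubatureFormula_shellUnion (hL : IsLeechLattice L) {t : ℕ} (ht : t ≤ 19)
    {M : Finset ℕ} {w : ℕ → ℝ} (hM : ∀ m ∈ M, 0 < m ∧ Even m) (hw : ∀ m ∈ M, 0 < w m)
    (h0 : ∑ m ∈ M, w m * (shell L m).ncard = 1)
    (h : ∀ j ∈ ({6, 8, 9} : Finset ℕ), 2 * j ≤ t → ∀ p ∈ harmonicPoly 24 (2 * j),
      ∑ m ∈ M, (w m : ℂ) * ((m : ℂ)⁻¹ ^ j * ∑ᶠ x ∈ shell L m, polyEval p x) = 0) :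
    IsCubatureFormula t (shellUnion L M) (shellWeight L M w) := by
  refine hL.evenUnimodular.isCubatureFormula_shellUnion (by norm_num) (fun m hm ↦ (hM m hm).1) hw
    h0 fun j hj hjt p hp ↦ ?_
  by_cases hj' : j ∈ ({6, 8, 9} : Finset ℕ)
  · exact h j hj' hjt p hp
  refine Finset.sum_eq_zero fun m hm ↦ ?_
  obtain ⟨i, rfl⟩ := even_iff_two_dvd.mp (hM m hm).2
  have hk : 2 * j ∈ ({2, 4, 6, 8, 10, 14} : Finset ℕ) := by
    simp only [Finset.mem_insert, Finset.mem_singleton] at hj' ⊢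
    omega
  have hz : ∑ᶠ x ∈ shell L (2 * i), polyEval p x = 0 := hL.thetaCoeff_eq_zero hk hp i
  rw [hz, mul_zero, mul_zero]

/-- In strength `11` no degree imposes a condition on the weights, so every shell is a design. -/
theorem IsLeechLattice.isSphericalDesign_rescaledShell (hL : IsLeechLattice L) {m : ℕ}
    (hm : 0 < m) (hne : (shell L m).Nonempty) : IsSphericalDesign 11 (rescaledShell L m) := by
  have hfin := hL.evenUnimodular.finite_shell m
  have hpos : 0 < (shell L m).ncard := (Set.ncard_pos hfin).mpr hne
  -- the lattice is even, so a nonempty shell has even norm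
  have heven : Even m := by
    obtain ⟨x, hx, hxm⟩ := hne
    obtain ⟨k, hk⟩ := hL.evenUnimodular.exists_norm_sq ⟨x, hx⟩
    have : m = 2 * k := by exact_mod_cast hxm.symm.trans hk
    exact this ▸ even_two_mul k
  have h := hL.isCubatureFormula_shellUnion (t := 11) (by norm_num) (M := {m})
    (w := fun _ ↦ ((shell L m).ncard : ℝ)⁻¹)
    (by simpa using ⟨hm, heven⟩) (by simpa using hpos)
    (by
      rw [Finset.sum_singleton]
      exact inv_mul_cancel₀ (by exact_mod_cast hpos.ne'))
    (fun j hj hj' ↦ by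
      simp only [Finset.mem_insert, Finset.mem_singleton] at hj
      omega)
  have hU : shellUnion L {m} = rescaledShell L m := by simp [shellUnion]
  rw [hU] at h
  refine h.congr fun x hx ↦ ?_
  simp [shellWeight, Set.indicator_of_mem hx, ncard_rescaledShell hm]

theorem IsLeechLattice.ncard_shellUnion (hL : IsLeechLattice L) :
    (shellUnion L {4}).ncard = 196560 ∧ (shellUnion L {4, 6}).ncard = 16969680 ∧
      (shellUnion L {4, 6, 8}).ncard = 415003680 ∧
      (shellUnion L {4, 6, 8, 10}).ncard = 5044384800 := by
  obtain ⟨h4, h6, h8, h10⟩ := hL.ncard_shell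
  have h (M : Finset ℕ) (hM : M ⊆ {4, 6, 8, 10}) :
      (shellUnion L M).ncard = ∑ m ∈ M, (shell L m).ncard := by
    refine hL.evenUnimodular.ncard_shellUnion (fun m hm ↦ ?_)
      (hL.pairwiseDisjoint_rescaledShell.subset fun m hm ↦ by simpa using hM hm)
    have := hM hm
    simp only [Finset.mem_insert, Finset.mem_singleton] at this
    omega
  refine ⟨?_, ?_, ?_, ?_⟩ <;> rw [h _ (by decide)] <;> simp [h4, h6, h8, h10]

/-- In strength `15`, the one condition comes from degree `12`, where the sums over the shells are
proportional to the coefficients `1, -48` of `Δ²`. -/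
theorem IsLeechLattice.isCubatureFormula_fifteen (hL : IsLeechLattice L) {w : ℕ → ℝ}
    (w4 : w 4 = 1 / 4176900) (w6 : w 6 = (3 / 4) ^ 5 * w 4) :
    IsCubatureFormula 15 (shellUnion L {4, 6}) (shellWeight L {4, 6} w) := by
  obtain ⟨h4, h6, -, -⟩ := hL.ncard_shell
  rw [w4] at w6
  refine hL.isCubatureFormula_shellUnion (by norm_num) (by decide) ?_ ?_ fun j hj hjt p hp ↦ ?_
  · simp [w4, w6]
  · norm_num [w4, w6, h4, h6]
  · obtain rfl : j = 6 := by
      simp only [Finset.mem_insert, Finset.mem_singleton] at hj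
      omega
    obtain ⟨e3, -, -⟩ := hL.thetaCoeff_twelve hp
    change ∑ᶠ x ∈ shell L 6, polyEval p x = _ at e3
    have e2 : ∑ᶠ x ∈ shell L 4, polyEval p x = thetaCoeff L p 2 := rfl
    rw [Finset.sum_insert (by decide), Finset.sum_singleton, e3, e2, w4, w6]
    push_cast
    ring

/-- In strength `17`, the conditions come from degrees `12` and `16`, where the sums over the shells
are proportional to the coefficients of `Δ²` and `E₄ Δ²`. -/
theorem IsLeechLattice.isCubatureFormula_seventeen (hL : IsLeechLattice L) {w : ℕ → ℝ}
    (w4 : w 4 = 1 / 555527700) (w6 : w 6 = 27 / 3009843200) (w8 : w 8 = 8 / 3749811975) :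
    IsCubatureFormula 17 (shellUnion L {4, 6, 8}) (shellWeight L {4, 6, 8} w) := by
  obtain ⟨h4, h6, h8, -⟩ := hL.ncard_shell
  refine hL.isCubatureFormula_shellUnion (by norm_num) (by decide) ?_ ?_ fun j hj hjt p hp ↦ ?_
  · simp [w4, w6, w8]
  · norm_num [w4, w6, w8, h4, h6, h8]
  · have e2 : ∑ᶠ x ∈ shell L 4, polyEval p x = thetaCoeff L p 2 := rfl
    have e3 : ∑ᶠ x ∈ shell L 6, polyEval p x = thetaCoeff L p 3 := rfl
    have e4 : ∑ᶠ x ∈ shell L 8, polyEval p x = thetaCoeff L p 4 := rfl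
    rw [Finset.sum_insert (by decide), Finset.sum_insert (by decide), Finset.sum_singleton,
      e2, e3, e4, w4, w6, w8]
    have hj' : j = 6 ∨ j = 8 := by
      simp only [Finset.mem_insert, Finset.mem_singleton] at hj
      omega
    rcases hj' with rfl | rfl
    · obtain ⟨a3, a4, -⟩ := hL.thetaCoeff_twelve hp
      rw [a3, a4]
      push_cast
      ring
    · obtain ⟨a3, a4, -⟩ := hL.thetaCoeff_sixteen hp
      rw [a3, a4]
      push_cast
      ring

/-- In strength `19`, the conditions come from degrees `12`, `16` and `18`, where the sums over the
shells are proportional to the coefficients of `Δ²`, `E₄ Δ²` and `E₆ Δ²`. -/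
theorem IsLeechLattice.isCubatureFormula_nineteen (hL : IsLeechLattice L) {w : ℕ → ℝ}
    (w4 : w 4 = 1 / 749962395) (w6 : w 6 = 243 / 185406341120)
    (w8 : w 8 = 32 / 41247931725) (w10 : w 10 = 15625 / 108128978141184) :
    IsCubatureFormula 19 (shellUnion L {4, 6, 8, 10}) (shellWeight L {4, 6, 8, 10} w) := by
  obtain ⟨h4, h6, h8, h10⟩ := hL.ncard_shell
  refine hL.isCubatureFormula_shellUnion (by norm_num) (by decide) ?_ ?_ fun j hj hjt p hp ↦ ?_
  · simp [w4, w6, w8, w10]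
  · norm_num [w4, w6, w8, w10, h4, h6, h8, h10]
  · have e2 : ∑ᶠ x ∈ shell L 4, polyEval p x = thetaCoeff L p 2 := rfl
    have e3 : ∑ᶠ x ∈ shell L 6, polyEval p x = thetaCoeff L p 3 := rfl
    have e4 : ∑ᶠ x ∈ shell L 8, polyEval p x = thetaCoeff L p 4 := rfl
    have e5 : ∑ᶠ x ∈ shell L 10, polyEval p x = thetaCoeff L p 5 := rfl
    rw [Finset.sum_insert (by decide), Finset.sum_insert (by decide),
      Finset.sum_insert (by decide), Finset.sum_singleton, e2, e3, e4, e5, w4, w6, w8, w10]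
    simp only [Finset.mem_insert, Finset.mem_singleton] at hj
    rcases hj with rfl | rfl | rfl
    · obtain ⟨a3, a4, a5⟩ := hL.thetaCoeff_twelve hp
      rw [a3, a4, a5]
      push_cast
      ring
    · obtain ⟨a3, a4, a5⟩ := hL.thetaCoeff_sixteen hp
      rw [a3, a4, a5]
      push_cast
      ring
    · obtain ⟨a3, a4, a5⟩ := hL.thetaCoeff_eighteen hp
      rw [a3, a4, a5]
      push_cast
      ring

lemma IsLeechLattice.exists_thetaSeries_twelve (hL : IsLeechLattice L) :
    ∃ c : harmonicPoly 24 12 →ₗ[ℂ] ℂ, ∀ P : harmonicPoly 24 12,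
      HasThetaSeries L P (fun z ↦ c P * discriminant z ^ 2) := by
  obtain ⟨c, hc⟩ := hL.exists_thetaSeries_eq (k := 12) (by norm_num) (by norm_num)
    (g := discriminantSqForm) hasCoeffs_discriminantSq
  refine ⟨c, fun P z ↦ ?_⟩
  beta_reduce
  rw [← discriminantSqForm_apply]
  exact hc P z

lemma IsLeechLattice.exists_thetaSeries_sixteen (hL : IsLeechLattice L) :
    ∃ c : harmonicPoly 24 16 →ₗ[ℂ] ℂ, ∀ P : harmonicPoly 24 16,
      HasThetaSeries L P (fun z ↦ c P * (E₄ z * discriminant z ^ 2)) := by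
  obtain ⟨c, hc⟩ := hL.exists_thetaSeries_eq (k := 16) (by norm_num) (by norm_num)
    (g := E₄DiscriminantSqForm) hasCoeffs_E₄DiscriminantSq
  refine ⟨c, fun P z ↦ ?_⟩
  beta_reduce
  rw [← E₄DiscriminantSqForm_apply]
  exact hc P z

lemma IsLeechLattice.exists_thetaSeries_eighteen (hL : IsLeechLattice L) :
    ∃ c : harmonicPoly 24 18 →ₗ[ℂ] ℂ, ∀ P : harmonicPoly 24 18,
      HasThetaSeries L P (fun z ↦ c P * (E₆ z * discriminant z ^ 2)) := by
  obtain ⟨c, hc⟩ := hL.exists_thetaSeries_eq (k := 18) (by norm_num) (by norm_num)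
    (g := E₆DiscriminantSqForm) hasCoeffs_E₆DiscriminantSq
  refine ⟨c, fun P z ↦ ?_⟩
  beta_reduce
  rw [← E₆DiscriminantSqForm_apply]
  exact hc P z

end LeechCubature

theorem mainTheorem3 (L : Submodule ℤ (EuclideanSpace ℝ (Fin 24))) (hL : IsLeechLattice L) :
    -- the theta series with harmonic coefficients
    (HasThetaSeries L 1
      (fun z => ModularForm.E₄ z ^ 3 - 720 * ModularForm.discriminant z)) ∧
    (∀ k ∈ ({2, 4, 6, 8, 10, 14} : Finset ℕ), ∀ P ∈ harmonicPoly 24 k,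
      HasThetaSeries L P (fun _ => 0)) ∧
    (∃ c : harmonicPoly 24 12 →ₗ[ℂ] ℂ, ∀ P : harmonicPoly 24 12,
      HasThetaSeries L P (fun z => c P * ModularForm.discriminant z ^ 2)) ∧
    (∃ c : harmonicPoly 24 16 →ₗ[ℂ] ℂ, ∀ P : harmonicPoly 24 16,
      HasThetaSeries L P
        (fun z => c P * (ModularForm.E₄ z * ModularForm.discriminant z ^ 2))) ∧
    (∃ c : harmonicPoly 24 18 →ₗ[ℂ] ℂ, ∀ P : harmonicPoly 24 18,
      HasThetaSeries L P
        (fun z => c P * (ModularForm.E₆ z * ModularForm.discriminant z ^ 2))) ∧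
    -- the rescaled shells used below are pairwise disjoint
    (({4, 6, 8, 10} : Set ℕ).PairwiseDisjoint (rescaledShell L)) ∧
    -- strength 11: every nonempty shell is a spherical design; shell of norm 4
    (∀ m : ℕ, 0 < m → (shell L m).Nonempty → IsSphericalDesign 11 (rescaledShell L m)) ∧
    (shellUnion L {4}).ncard = 196560 ∧
    -- strength 15: shells of norms 4, 6
    (∃ w : ℕ → ℝ, w 4 = 1 / 4176900 ∧ w 6 = (3 / 4) ^ 5 * w 4 ∧
      IsCubatureFormula 15 (shellUnion L {4, 6}) (shellWeight L {4, 6} w)) ∧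
    (shellUnion L {4, 6}).ncard = 16969680 ∧
    -- strength 17: shells of norms 4, 6, 8
    (∃ w : ℕ → ℝ, w 4 = 1 / 555527700 ∧ w 6 = 27 / 3009843200 ∧ w 8 = 8 / 3749811975 ∧
      IsCubatureFormula 17 (shellUnion L {4, 6, 8}) (shellWeight L {4, 6, 8} w)) ∧
    (shellUnion L {4, 6, 8}).ncard = 415003680 ∧
    -- strength 19: shells of norms 4, 6, 8, 10
    (∃ w : ℕ → ℝ, w 4 = 1 / 749962395 ∧ w 6 = 243 / 185406341120 ∧
      w 8 = 32 / 41247931725 ∧ w 10 = 15625 / 108128978141184 ∧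
      IsCubatureFormula 19 (shellUnion L {4, 6, 8, 10}) (shellWeight L {4, 6, 8, 10} w)) ∧
    (shellUnion L {4, 6, 8, 10}).ncard = 5044384800 := by
  have hw (a b c d : ℝ) : ∃ w : ℕ → ℝ, w 4 = a ∧ w 6 = b ∧ w 8 = c ∧ w 10 = d :=
    ⟨fun m ↦ if m = 4 then a else if m = 6 then b else if m = 8 then c else d, by simp⟩
  obtain ⟨n1, n2, n3, n4⟩ := hL.ncard_shellUnion
  refine ⟨hL.thetaSeries_one, fun k hk P hP ↦ hL.thetaSeries_eq_zero hk hP,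
    hL.exists_thetaSeries_twelve, hL.exists_thetaSeries_sixteen, hL.exists_thetaSeries_eighteen,
    hL.pairwiseDisjoint_rescaledShell, fun m hm hne ↦ hL.isSphericalDesign_rescaledShell hm hne,
    n1, ?_, n2, ?_, n3, ?_, n4⟩
  · obtain ⟨w, w4, w6, -, -⟩ := hw (1 / 4176900) ((3 / 4) ^ 5 * (1 / 4176900)) 0 0
    rw [← w4] at w6
    exact ⟨w, w4, w6, hL.isCubatureFormula_fifteen w4 w6⟩
  · obtain ⟨w, w4, w6, w8, -⟩ := hw (1 / 555527700) (27 / 3009843200) (8 / 3749811975) 0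
    exact ⟨w, w4, w6, w8, hL.isCubatureFormula_seventeen w4 w6 w8⟩
  · obtain ⟨w, w4, w6, w8, w10⟩ := hw (1 / 749962395) (243 / 185406341120)
      (32 / 41247931725) (15625 / 108128978141184)
    exact ⟨w, w4, w6, w8, w10, hL.isCubatureFormula_nineteen w4 w6 w8 w10⟩
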